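/- **Theorem.** Let $d\ge 1$, let $X_1,X_2,\dots$ and $Y_1,Y_2,\dots$ be random vectors in $\mathbb{R}^d$ which are all independent and identically distributed, with $\mathbf{E}\|X_1\|<\infty$ and characteristic function $\varphi(t)=\mathbf{E}e^{it^{T}X_1}$. Let $R^X_i, R^Y_j\in\{0,1\}^d$ be the response indicator vectors of $X_i$ and $Y_j$ (the $k$-th entry is $1$ if the $k$-th component is observed), and let $S_i^X=\prod_{k=1}^d R_{i,k}^X$, $S_j^Y=\prod_{k=1}^d R_{j,k}^Y$ be the indicators that a case is complete. Assume that the vectors $R_1^X,R_2^X,\dots,R_1^Y,R_2^Y,\dots$ are independent, that the data are missing completely at random (MCAR: the family of all $R^X_i,R^Y_j$ is independent of the family of all $X_i,Y_j$), and that $\mathbf{E}S_i^X=\mathbf{E}S_j^Y=q$ for all $i,j$, for some $q>0$. Put $\hat n=\sum_{i=1}^n S_i^X$, $\hat m=\sum_{j=1}^m S_j^Y$, $$T_{nm}=\frac{2}{nm}\sum_{i=1}^n\sum_{j=1}^m\|X_i-Y_j\|-\frac1{n^2}\sum_{i,j=1}^n\|X_i-X_j\|-\frac1{m^2}\sum_{i,j=1}^m\|Y_i-Y_j\|,$$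 $$T^{CC}_{nm}=\frac{2}{\hat n\hat m}\sum_{i=1}^n\sum_{j=1}^m\|X_i-Y_j\|S_i^XS_j^Y-\frac1{\hat n^2}\sum_{i,j=1}^n\|X_i-X_j\|S_i^XS_j^X-\frac1{\hat m^2}\sum_{i,j=1}^m\|Y_i-Y_j\|S_i^YS_j^Y,$$ where $\frac{\hat n\hat m}{\hat n+\hat m}T^{CC}_{nm}$ is read as $0$ if $\hat n\hat m=0$. Then, as $n,m\to\infty$ with $n/(n+m)\to\lambda^2$, both scaled statistics have the same limit in distribution: $$\frac{nm}{n+m}T_{nm}\overset{D}{\to}\|Z\|_w^2,\qquad \frac{\hat n\hat m}{\hat n+\hat m}T^{CC}_{nm}\overset{D}{\to}\|Z\|_w^2 .$$ Here $\{Z(t): t\in\mathbb{R}^d\}$ is a measurable centered Gaussian process (such a process exists) with covariance function $$C(t,s)=\mathbf{E}(Z(s)Z(t))=\mathrm{Re}\,\varphi(s-t)+\mathrm{Im}\,\varphi(s+t)-\mathrm{Re}\,\varphi(t)\,\mathrm{Re}\,\varphi(s)-\mathrm{Im}\,\varphi(s)\,\mathrm{Re}\,\varphi(t)-\mathrm{Re}\,\varphi(s)\,\mathrm{Im}\,\varphi(t)-\mathrm{Im}\,\varphi(s)\,\mathrm{Im}\,\varphi(t),$$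 and $\|f\|_w^2=\int_{\mathbb{R}^d}f(t)^2w(t)\,\mathrm{d}t$ with $w(t)=\dfrac{\Gamma\left(\frac{d+1}{2}\right)}{\pi^{(d+1)/2}\,\|t\|^{d+1}}$. The integral $\|Z\|_w^2$ is almost surely finite, and the law of $\|Z\|_w^2$, hence the limit, is the same for every such process $Z$. -/

import Mathlib

open MeasureTheory ProbabilityTheory Filter Topology

noncomputable section

/-- The two-sample energy statistic of `x 0, …, x (n-1)` and `y 0, …, y (m-1)`,
for the Euclidean distance on `ℝ^d`. -/
def energyStat {d : ℕ} (n m : ℕ) (x y : ℕ → EuclideanSpace ℝ (Fin d)) : ℝ :=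
  2 / ((n : ℝ) * m) * ∑ i ∈ Finset.range n, ∑ j ∈ Finset.range m, dist (x i) (y j)
    - 1 / (n : ℝ) ^ 2 * ∑ i ∈ Finset.range n, ∑ j ∈ Finset.range n, dist (x i) (x j)
    - 1 / (m : ℝ) ^ 2 * ∑ i ∈ Finset.range m, ∑ j ∈ Finset.range m, dist (y i) (y j)

/-- The indicator `S` that a case with response indicator vector `r` is complete: the product of
the `0/1` response indicators of its components (`true` means observed). -/
def completeInd {d : ℕ} (r : Fin d → Bool) : ℝ :=
  ∏ k, if r k = true then (1 : ℝ) else 0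

/-- The number of complete cases among the first `n` cases. -/
def completeCount {d : ℕ} (n : ℕ) (r : ℕ → Fin d → Bool) : ℝ :=
  ∑ i ∈ Finset.range n, completeInd (r i)

/-- The complete-case energy statistic: the energy statistic computed from the complete cases
only. The factors `1 / 0 = 0` occur only when a sample has no complete case. -/
def energyStatCC {d : ℕ} (n m : ℕ) (x y : ℕ → EuclideanSpace ℝ (Fin d))
    (rx ry : ℕ → Fin d → Bool) : ℝ :=
  2 / (completeCount n rx * completeCount m ry) *
      ∑ i ∈ Finset.range n, ∑ j ∈ Finset.range m,
        dist (x i) (y j) * completeInd (rx i) * completeInd (ry j)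
    - 1 / completeCount n rx ^ 2 *
      ∑ i ∈ Finset.range n, ∑ j ∈ Finset.range n,
        dist (x i) (x j) * completeInd (rx i) * completeInd (rx j)
    - 1 / completeCount m ry ^ 2 *
      ∑ i ∈ Finset.range m, ∑ j ∈ Finset.range m,
        dist (y i) (y j) * completeInd (ry i) * completeInd (ry j)

/-- The weight `w(t) = Γ((d+1)/2) / (π^((d+1)/2) ‖t‖^(d+1))` on `ℝ^d`, for which the energy
statistic is the `w`-weighted `L²` distance of the empirical characteristic functions. -/
def energyWeight {d : ℕ} (t : EuclideanSpace ℝ (Fin d)) : ℝ :=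
  Real.Gamma (((d : ℝ) + 1) / 2) / (Real.pi ^ (((d : ℝ) + 1) / 2) * ‖t‖ ^ (d + 1))

/-- `⟨f, g⟩_w = ∫ f(t) g(t) w(t) dt`. -/
def weightedInner {d : ℕ} (f g : EuclideanSpace ℝ (Fin d) → ℝ) : ℝ :=
  ∫ t, f t * g t * energyWeight t

/-- `‖f‖²_w = ⟨f, f⟩_w`. -/
def weightedNormSq {d : ℕ} (f : EuclideanSpace ℝ (Fin d) → ℝ) : ℝ :=
  weightedInner f f

/-- The covariance function `C(t, s)` of the limit process, in terms of the characteristic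
function `φ`. -/
def limitCov {d : ℕ} (φ : EuclideanSpace ℝ (Fin d) → ℂ) (t s : EuclideanSpace ℝ (Fin d)) : ℝ :=
  (φ (s - t)).re + (φ (s + t)).im
    - (φ t).re * (φ s).re - (φ s).im * (φ t).re - (φ s).re * (φ t).im - (φ s).im * (φ t).im

/-- `Z` is a (measurable) centered Gaussian process indexed by `ℝ^d` whose covariance function is
`limitCov φ`. -/
structure IsLimitProcess {d : ℕ} {Ω' : Type*} [MeasurableSpace Ω']
    (φ : EuclideanSpace ℝ (Fin d) → ℂ)
    (Z : EuclideanSpace ℝ (Fin d) → Ω' → ℝ) (P' : Measure Ω') : Prop where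
  measurable : Measurable (fun p : EuclideanSpace ℝ (Fin d) × Ω' => Z p.1 p.2)
  gaussian : IsGaussianProcess Z P'
  centered : ∀ t, ∫ ω, Z t ω ∂P' = 0
  covariance : ∀ t s, ∫ ω, Z s ω * Z t ω ∂P' = limitCov φ t s

/-- Missing completely at random: the response indicators of both samples are jointly independent
of the data of both samples. -/
def MCAR {d : ℕ} {Ω : Type*} [MeasurableSpace Ω]
    (X Y : ℕ → Ω → EuclideanSpace ℝ (Fin d)) (RX RY : ℕ → Ω → Fin d → Bool)
    (P : Measure Ω) : Prop :=
  IndepFun (fun ω (k : ℕ ⊕ ℕ) => Sum.elim X Y k ω)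
    (fun ω (k : ℕ ⊕ ℕ) => Sum.elim RX RY k ω) P

end

/-!
Let `ξ` be the pooled sample. For weights `c i` that sum to zero, the energy quadratic form
`-∑ c i c j ‖ξ i - ξ j‖` equals `‖∑ c i cas(·, ξ i)‖²_w`, where `cas t x = cos ⟪x, t⟫ + sin ⟪x, t⟫`
(`weightedNormSq_sum_cas`). This rests on `∫ (1 - cos ⟪x, t⟫) w(t) dt = ‖x‖`, proved by writing the
weight as a mixture of Gaussians (`lintegral_one_sub_cos_mul_energyWeight`). With the missingness
pattern held fixed, the scaled complete-case statistic is such a form, with weights of unit sum of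
squares and maximum tending to zero as the numbers of complete cases grow (`contrastWeight`,
`scaledEnergyStatCC_eq`). The full-sample statistic is the case in which nothing is missing. The
weights need not stabilize: only the normalization of their squares matters.

The process `t ↦ ∑ c i cas(t, ξ i)` converges to `Z` in finite-dimensional distributions, by
characteristic functions (`IsNegligibleContrast.tendsto_integral_sum_cas`): the covariance `C` is
that of `cas t` and `cas s` under the law of the data. No tightness in a function space is needed to
pass to the integral functional `‖·‖²_w`: for a finite measure the integral is, in `L²`, close to an
average over randomly sampled points, and this average is governed by the finite-dimensional
distributions for each choice of the points. The required uniform fourth moments come from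
subgaussianity. Sets of infinite measure are cut off using `∫ C(t, t) w(t) dt < ∞`, which is where
`E ‖X‖ < ∞` enters (`tendsto_integral_integral_of_tendsto_average`, `lintegral_limitCov_ne_top`).

By MCAR, the missingness pattern can be replaced by an independent copy (`MCAR.integral_eq`). Almost
every pattern has infinitely many complete cases by Borel–Cantelli, and dominated convergence over
the patterns finishes the proof.

The process `Z` is constructed as a random series `∑ ⟨e n, cas t - E cas t⟩ g n`, for an orthonormal
basis `e` of `L²` of the law of the data and independent standard normal `g n`, which converges
almost surely by martingale convergence (`exists_isLimitProcess`).
-/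

open scoped ENNReal NNReal RealInnerProductSpace

/-! ### The energy weight -/

lemma energyWeight_nonneg {d : ℕ} (t : EuclideanSpace ℝ (Fin d)) : 0 ≤ energyWeight t := by
  unfold energyWeight
  have := Real.Gamma_nonneg_of_nonneg (s := ((d : ℝ) + 1) / 2) (by positivity)
  positivity

@[fun_prop]
lemma measurable_energyWeight {d : ℕ} :
    Measurable (energyWeight : EuclideanSpace ℝ (Fin d) → ℝ) := by
  unfold energyWeight
  fun_prop

lemma energyWeight_neg {d : ℕ} (t : EuclideanSpace ℝ (Fin d)) :
    energyWeight (-t) = energyWeight t := by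
  simp [energyWeight]

/-- The Gamma integral writes the weight, away from the origin, as a mixture of Gaussians. -/
lemma ofReal_mul_energyWeight_eq_lintegral {d : ℕ} (t : EuclideanSpace ℝ (Fin d)) {a : ℝ}
    (ha : 0 ≤ a) (ha0 : t = 0 → a = 0) :
    ENNReal.ofReal (a * energyWeight t) = ∫⁻ s in Set.Ioi (0 : ℝ),
      ENNReal.ofReal (a * Real.pi ^ (-(((d : ℝ) + 1) / 2)) *
        (s ^ (((d : ℝ) + 1) / 2 - 1) * Real.exp (-(‖t‖ ^ 2 * s)))) := by
  rcases eq_or_ne t 0 with rfl | ht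
  · simp [ha0 rfl]
  have hr : 0 < ‖t‖ ^ 2 := by positivity
  have hd : 0 < ((d : ℝ) + 1) / 2 := by positivity
  have key := Real.integral_rpow_mul_exp_neg_mul_Ioi hd hr
  have hpos : 0 < (1 / ‖t‖ ^ 2) ^ (((d : ℝ) + 1) / 2) * Real.Gamma (((d : ℝ) + 1) / 2) :=
    mul_pos (by positivity) (Real.Gamma_pos_of_pos hd)
  have hint : IntegrableOn (fun s : ℝ => s ^ (((d : ℝ) + 1) / 2 - 1) * Real.exp (-(‖t‖ ^ 2 * s)))
      (Set.Ioi 0) := by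
    apply Integrable.of_integral_ne_zero
    rw [key]; exact hpos.ne'
  rw [← ofReal_integral_eq_lintegral_ofReal (hint.const_mul _), integral_const_mul, key]
  · congr 1
    unfold energyWeight
    have h1 : (1 / ‖t‖ ^ 2) ^ (((d : ℝ) + 1) / 2) = (‖t‖ ^ (d + 1))⁻¹ := by
      rw [one_div, Real.inv_rpow (by positivity), ← Real.rpow_natCast,
        ← Real.rpow_mul (by positivity)]
      congr 1
      rw [← Real.rpow_natCast]
      congr 1
      push_cast; ring
    rw [h1, Real.rpow_neg Real.pi_pos.le]
    field_simp
  · filter_upwards [ae_restrict_mem measurableSet_Ioi] with s hs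
    have : (0 : ℝ) < s := hs
    positivity

/-- The Gaussian Fourier integral, in the real form used for the energy identity. -/
lemma lintegral_one_sub_cos_mul_exp {d : ℕ} (x : EuclideanSpace ℝ (Fin d)) {s : ℝ} (hs : 0 < s) :
    ∫⁻ t : EuclideanSpace ℝ (Fin d),
        ENNReal.ofReal ((1 - Real.cos ⟪x, t⟫) * Real.exp (-(‖t‖ ^ 2 * s))) =
      ENNReal.ofReal ((Real.pi / s) ^ ((d : ℝ) / 2) * (1 - Real.exp (-(‖x‖ ^ 2 / (4 * s))))) := by
  have hb : 0 < ((s : ℝ) : ℂ).re := by simpa using hs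
  have e0 (c : ℂ) (t : EuclideanSpace ℝ (Fin d)) (y : ℝ) (hc : c = 0 ∧ y = 1 ∨
      c = Complex.I ∧ y = Real.cos ⟪x, t⟫) :
      (Complex.exp (-(s : ℂ) * (‖t‖ : ℂ) ^ 2 + c * (⟪x, t⟫ : ℝ))).re =
        y * Real.exp (-(‖t‖ ^ 2 * s)) := by
    have h1 : Complex.exp (-(s : ℂ) * (‖t‖ : ℂ) ^ 2) = (Real.exp (-(‖t‖ ^ 2 * s)) : ℝ) := by
      push_cast; congr 1; ring
    rw [Complex.exp_add, h1, Complex.re_ofReal_mul]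
    rcases hc with ⟨rfl, rfl⟩ | ⟨rfl, rfl⟩
    · simp
    · rw [mul_comm Complex.I, Complex.exp_ofReal_mul_I_re]; ring
  have hpow : ((Real.pi : ℂ) / (s : ℂ)) ^ ((Module.finrank ℝ (EuclideanSpace ℝ (Fin d)) : ℂ) / 2) =
      (((Real.pi / s) ^ ((d : ℝ) / 2) : ℝ) : ℂ) := by
    rw [Complex.ofReal_cpow (by positivity)]
    simp
  have i0 := (GaussianFourier.integrable_cexp_neg_mul_sq_norm_add hb 0 x).re
  have i1 := (GaussianFourier.integrable_cexp_neg_mul_sq_norm_add hb Complex.I x).re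
  have v0 := congrArg Complex.re (GaussianFourier.integral_cexp_neg_mul_sq_norm_add hb 0 x)
  have v1 := congrArg Complex.re (GaussianFourier.integral_cexp_neg_mul_sq_norm_add hb Complex.I x)
  rw [hpow, Complex.re_ofReal_mul] at v0 v1
  have hx : Complex.exp (Complex.I ^ 2 * (‖x‖ : ℂ) ^ 2 / (4 * (s : ℂ))) =
      (Real.exp (-(‖x‖ ^ 2 / (4 * s))) : ℝ) := by
    push_cast; congr 1; rw [Complex.I_sq]; ring
  rw [hx, Complex.ofReal_re] at v1
  have hre (c : ℂ) := integral_re (GaussianFourier.integrable_cexp_neg_mul_sq_norm_add hb c x)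
  simp only [RCLike.re_to_complex] at i0 i1 hre
  rw [← hre] at v0 v1
  simp only [e0 0 _ 1 (Or.inl ⟨rfl, rfl⟩), e0 Complex.I _ _ (Or.inr ⟨rfl, rfl⟩)] at i0 i1 v0 v1
  have hsub : (fun t : EuclideanSpace ℝ (Fin d) =>
      (1 - Real.cos ⟪x, t⟫) * Real.exp (-(‖t‖ ^ 2 * s))) = fun t =>
      1 * Real.exp (-(‖t‖ ^ 2 * s)) - Real.cos ⟪x, t⟫ * Real.exp (-(‖t‖ ^ 2 * s)) := by
    ext t; ring
  rw [← ofReal_integral_eq_lintegral_ofReal]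
  · rw [hsub, integral_sub i0 i1, v0, v1]
    simp [mul_sub]
  · rw [hsub]; exact i0.sub i1
  · exact ae_of_all _ fun t => mul_nonneg (sub_nonneg.2 (Real.cos_le_one _)) (Real.exp_pos _).le

/-- The substitution `s ↦ s⁻¹` turns this into the Gamma integral at `1 / 2`. -/
lemma lintegral_rpow_mul_exp_neg_div {v : ℝ} (hv : 0 < v) :
    ∫⁻ s in Set.Ioi (0 : ℝ), ENNReal.ofReal (s ^ (-(3 / 2) : ℝ) * Real.exp (-(v / s))) =
      ENNReal.ofReal (Real.sqrt Real.pi * v ^ (-(1 / 2) : ℝ)) := by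
  have key := Real.integral_rpow_mul_exp_neg_mul_Ioi (a := 1 / 2) (by norm_num) hv
  rw [Real.Gamma_one_half_eq, ← integral_comp_rpow_Ioi _ (p := -1) (by norm_num)] at key
  have e : ∀ s ∈ Set.Ioi (0 : ℝ), (|(-1 : ℝ)| * s ^ ((-1 : ℝ) - 1)) •
      ((s ^ (-1 : ℝ)) ^ ((1 : ℝ) / 2 - 1) *
      Real.exp (-(v * s ^ (-1 : ℝ)))) = s ^ (-(3 / 2) : ℝ) * Real.exp (-(v / s)) := by
    intro s hs
    have hs : 0 < s := hs
    rw [← Real.rpow_mul hs.le, abs_neg, abs_one, one_mul, smul_eq_mul, ← mul_assoc,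
      ← Real.rpow_add hs, Real.rpow_neg_one, ← div_eq_mul_inv]
    norm_num
  rw [setIntegral_congr_fun measurableSet_Ioi e] at key
  rw [← ofReal_integral_eq_lintegral_ofReal]
  · rw [key, one_div, Real.inv_rpow hv.le, Real.rpow_neg hv.le, mul_comm]
  · apply Integrable.of_integral_ne_zero
    rw [key]; positivity
  · filter_upwards [ae_restrict_mem measurableSet_Ioi] with s hs
    have : (0 : ℝ) < s := hs
    positivity

/-- Writing `1 - exp (-b / s)` as an integral over `(0, b]` reduces this to
`lintegral_rpow_mul_exp_neg_div`. -/
lemma lintegral_rpow_mul_one_sub_exp {b : ℝ} (hb : 0 ≤ b) :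
    ∫⁻ s in Set.Ioi (0 : ℝ), ENNReal.ofReal (s ^ (-(1 / 2) : ℝ) * (1 - Real.exp (-(b / s)))) =
      ENNReal.ofReal (2 * Real.sqrt Real.pi * Real.sqrt b) := by
  have h1 : ∀ s ∈ Set.Ioi (0 : ℝ), ENNReal.ofReal (s ^ (-(1 / 2) : ℝ) * (1 - Real.exp (-(b / s)))) =
      ∫⁻ v in Set.Ioc 0 b, ENNReal.ofReal (s ^ (-(3 / 2) : ℝ) * Real.exp (-(v / s))) := by
    intro s hs
    have hs : 0 < s := hs
    have hder : ∀ v ∈ Set.uIcc 0 b, HasDerivAt (fun v => - (s ^ (-(1 / 2) : ℝ) * Real.exp (-(v / s))))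
        (s ^ (-(3 / 2) : ℝ) * Real.exp (-(v / s))) v := by
      intro v _
      have := ((((hasDerivAt_id v).div_const s).neg.exp).const_mul (s ^ (-(1 / 2) : ℝ))).neg
      refine HasDerivAt.congr_deriv this ?_
      have h3 : s ^ (-(3 / 2) : ℝ) = s ^ (-(1 / 2) : ℝ) * s⁻¹ := by
        rw [← Real.rpow_neg_one, ← Real.rpow_add hs]; norm_num
      rw [h3]; simp [id]; ring
    have hc : Continuous fun v => s ^ (-(3 / 2) : ℝ) * Real.exp (-(v / s)) := by fun_prop
    have hi := intervalIntegral.integral_eq_sub_of_hasDerivAt hder (hc.intervalIntegrable _ _)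
    rw [intervalIntegral.integral_of_le hb] at hi
    rw [← ofReal_integral_eq_lintegral_ofReal, hi]
    · congr 1; simp; ring
    · exact (hc.continuousOn.integrableOn_Icc (a := 0) (b := b)).mono_set Set.Ioc_subset_Icc_self
    · exact ae_of_all _ fun v => by positivity
  rw [setLIntegral_congr_fun measurableSet_Ioi h1, lintegral_lintegral_swap]
  · rw [setLIntegral_congr_fun measurableSet_Ioc
      (fun v hv => lintegral_rpow_mul_exp_neg_div hv.1)]
    have hi : IntervalIntegrable (fun v : ℝ => v ^ (-(1 / 2) : ℝ)) volume 0 b :=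
      intervalIntegral.intervalIntegrable_rpow' (by norm_num)
    rw [← ofReal_integral_eq_lintegral_ofReal]
    · rw [integral_const_mul, ← intervalIntegral.integral_of_le hb,
        integral_rpow (Or.inl (by norm_num)), Real.sqrt_eq_rpow b]
      congr 1
      norm_num
      ring
    · exact ((intervalIntegrable_iff_integrableOn_Ioc_of_le hb).1 hi).const_mul _
    · filter_upwards [ae_restrict_mem measurableSet_Ioc] with v hv
      have : 0 < v := hv.1
      positivity
  · apply Measurable.aemeasurable
    unfold Function.uncurry
    fun_prop

/-- The identity behind the energy distance: `‖x‖` is the `w`-integral of `1 - cos ⟨x, t⟩`. -/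
theorem lintegral_one_sub_cos_mul_energyWeight {d : ℕ} (x : EuclideanSpace ℝ (Fin d)) :
    ∫⁻ t : EuclideanSpace ℝ (Fin d), ENNReal.ofReal ((1 - Real.cos ⟪x, t⟫) * energyWeight t) =
      ENNReal.ofReal ‖x‖ := by
  have h1 : ∀ t : EuclideanSpace ℝ (Fin d), 0 ≤ 1 - Real.cos ⟪x, t⟫ := fun t =>
    sub_nonneg.2 (Real.cos_le_one _)
  rw [lintegral_congr fun t => ofReal_mul_energyWeight_eq_lintegral t (h1 t)
    (by rintro rfl; simp), lintegral_lintegral_swap]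
  · have h2 : ∀ s ∈ Set.Ioi (0 : ℝ), (∫⁻ t : EuclideanSpace ℝ (Fin d),
        ENNReal.ofReal ((1 - Real.cos ⟪x, t⟫) * Real.pi ^ (-(((d : ℝ) + 1) / 2)) *
        (s ^ (((d : ℝ) + 1) / 2 - 1) * Real.exp (-(‖t‖ ^ 2 * s))))) =
        ENNReal.ofReal (Real.pi ^ (-(1 / 2) : ℝ)) *
        ENNReal.ofReal (s ^ (-(1 / 2) : ℝ) * (1 - Real.exp (-((‖x‖ ^ 2 / 4) / s)))) := by
      intro s hs
      have hs : 0 < s := hs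
      have hc : 0 ≤ Real.pi ^ (-(((d : ℝ) + 1) / 2)) * s ^ (((d : ℝ) + 1) / 2 - 1) := by positivity
      have e : ∀ t : EuclideanSpace ℝ (Fin d),
          ENNReal.ofReal ((1 - Real.cos ⟪x, t⟫) * Real.pi ^ (-(((d : ℝ) + 1) / 2)) *
          (s ^ (((d : ℝ) + 1) / 2 - 1) * Real.exp (-(‖t‖ ^ 2 * s)))) =
          ENNReal.ofReal (Real.pi ^ (-(((d : ℝ) + 1) / 2)) * s ^ (((d : ℝ) + 1) / 2 - 1)) *
          ENNReal.ofReal ((1 - Real.cos ⟪x, t⟫) * Real.exp (-(‖t‖ ^ 2 * s))) := by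
        intro t
        rw [← ENNReal.ofReal_mul hc]
        congr 1; ring
      rw [lintegral_congr e, lintegral_const_mul _ (by fun_prop), lintegral_one_sub_cos_mul_exp x hs,
        ← ENNReal.ofReal_mul hc, ← ENNReal.ofReal_mul (by positivity)]
      congr 1
      rw [← mul_assoc, ← mul_assoc, Real.div_rpow Real.pi_pos.le hs.le,
        div_eq_mul_inv (Real.pi ^ ((d : ℝ) / 2)),
        ← Real.rpow_neg hs.le, div_div]
      congr 1
      rw [show Real.pi ^ (-(((d : ℝ) + 1) / 2)) * s ^ (((d : ℝ) + 1) / 2 - 1) *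
        (Real.pi ^ ((d : ℝ) / 2) * s ^ (-((d : ℝ) / 2))) =
        (Real.pi ^ (-(((d : ℝ) + 1) / 2)) * Real.pi ^ ((d : ℝ) / 2)) *
        (s ^ (((d : ℝ) + 1) / 2 - 1) * s ^ (-((d : ℝ) / 2))) by ring,
        ← Real.rpow_add Real.pi_pos, ← Real.rpow_add hs]
      congr 2 <;> ring
    rw [setLIntegral_congr_fun measurableSet_Ioi h2, lintegral_const_mul _ (by fun_prop),
      lintegral_rpow_mul_one_sub_exp (by positivity), ← ENNReal.ofReal_mul (by positivity)]
    congr 1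
    rw [Real.rpow_neg Real.pi_pos.le, ← Real.sqrt_eq_rpow,
      show ‖x‖ ^ 2 / 4 = (‖x‖ / 2) ^ 2 by ring, Real.sqrt_sq (by positivity)]
    have : 0 < Real.sqrt Real.pi := by positivity
    field_simp
  · apply Measurable.aemeasurable
    unfold Function.uncurry
    fun_prop

lemma integrable_one_sub_cos_mul_energyWeight {d : ℕ} (x : EuclideanSpace ℝ (Fin d)) :
    Integrable fun t : EuclideanSpace ℝ (Fin d) => (1 - Real.cos ⟪x, t⟫) * energyWeight t := by
  refine ⟨by fun_prop, ?_⟩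
  rw [hasFiniteIntegral_iff_ofReal, lintegral_one_sub_cos_mul_energyWeight]
  · exact ENNReal.ofReal_lt_top
  · exact ae_of_all _ fun t => mul_nonneg (sub_nonneg.2 (Real.cos_le_one _)) (energyWeight_nonneg t)

lemma integral_one_sub_cos_mul_energyWeight {d : ℕ} (x : EuclideanSpace ℝ (Fin d)) :
    ∫ t : EuclideanSpace ℝ (Fin d), (1 - Real.cos ⟪x, t⟫) * energyWeight t = ‖x‖ := by
  rw [integral_eq_lintegral_of_nonneg_ae, lintegral_one_sub_cos_mul_energyWeight,
    ENNReal.toReal_ofReal (norm_nonneg _)]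
  · exact ae_of_all _ fun t => mul_nonneg (sub_nonneg.2 (Real.cos_le_one _)) (energyWeight_nonneg t)
  · fun_prop

/-- The function `cos ⟨x, t⟩ + sin ⟨x, t⟩`, which replaces the complex exponential so that the
limit process is real-valued. -/
noncomputable def cas {d : ℕ} (t x : EuclideanSpace ℝ (Fin d)) : ℝ :=
  Real.cos ⟪x, t⟫ + Real.sin ⟪x, t⟫

@[fun_prop]
lemma measurable_cas {d : ℕ} :
    Measurable fun p : EuclideanSpace ℝ (Fin d) × EuclideanSpace ℝ (Fin d) => cas p.1 p.2 := by
  unfold cas; fun_prop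

lemma abs_cas_le {d : ℕ} (t x : EuclideanSpace ℝ (Fin d)) : |cas t x| ≤ 2 := by
  unfold cas
  have := abs_add_le (Real.cos ⟪x, t⟫) (Real.sin ⟪x, t⟫)
  have := Real.abs_cos_le_one ⟪x, t⟫
  have := Real.abs_sin_le_one ⟪x, t⟫
  linarith

lemma cas_sub_sq_le {d : ℕ} (t x y : EuclideanSpace ℝ (Fin d)) :
    (cas t x - cas t y) ^ 2 ≤ 4 * (1 - Real.cos ⟪x - y, t⟫) := by
  unfold cas
  rw [inner_sub_left, Real.cos_sub]
  nlinarith [sq_nonneg ((Real.cos ⟪x, t⟫ - Real.cos ⟪y, t⟫) - (Real.sin ⟪x, t⟫ - Real.sin ⟪y, t⟫)),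
    Real.sin_sq_add_cos_sq ⟪x, t⟫, Real.sin_sq_add_cos_sq ⟪y, t⟫]

lemma integrable_cas_sub_sq_mul_energyWeight {d : ℕ} (x y : EuclideanSpace ℝ (Fin d)) :
    Integrable fun t : EuclideanSpace ℝ (Fin d) => (cas t x - cas t y) ^ 2 * energyWeight t := by
  refine ((integrable_one_sub_cos_mul_energyWeight (x - y)).const_mul 4).mono'
    (by unfold cas; fun_prop) (ae_of_all _ fun t => ?_)
  have hw := energyWeight_nonneg t
  rw [Real.norm_of_nonneg (by positivity), ← mul_assoc]
  exact mul_le_mul_of_nonneg_right (cas_sub_sq_le t x y) hw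

lemma integral_cas_sub_sq_mul_energyWeight {d : ℕ} (x y : EuclideanSpace ℝ (Fin d)) :
    ∫ t : EuclideanSpace ℝ (Fin d), (cas t x - cas t y) ^ 2 * energyWeight t = 2 * dist x y := by
  have h := integrable_cas_sub_sq_mul_energyWeight x y
  have h' := h.comp_neg
  -- averaging over `t` and `-t` removes the odd cross term
  have e : ∀ t : EuclideanSpace ℝ (Fin d), (cas t x - cas t y) ^ 2 * energyWeight t +
      (cas (-t) x - cas (-t) y) ^ 2 * energyWeight (-t) =
      4 * ((1 - Real.cos ⟪x - y, t⟫) * energyWeight t) := by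
    intro t
    simp only [cas, energyWeight_neg, inner_neg_right, Real.cos_neg, Real.sin_neg, inner_sub_left,
      Real.cos_sub]
    linear_combination 2 * energyWeight t * (Real.sin_sq_add_cos_sq ⟪x, t⟫ +
      Real.sin_sq_add_cos_sq ⟪y, t⟫)
  have hs := integral_add h h'
  rw [integral_neg_eq_self
    (fun t : EuclideanSpace ℝ (Fin d) => (cas t x - cas t y) ^ 2 * energyWeight t)] at hs
  simp only [e] at hs
  rw [integral_const_mul, integral_one_sub_cos_mul_energyWeight, ← dist_eq_norm] at hs
  linarith

lemma sq_sum_of_sum_eq_zero {ι : Type*} (s : Finset ι) (c f : ι → ℝ) (hc : ∑ i ∈ s, c i = 0) :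
    (∑ i ∈ s, c i * f i) ^ 2 = ∑ i ∈ s, ∑ j ∈ s, -(c i * c j / 2) * (f i - f j) ^ 2 := by
  have e : ∀ i j, -(c i * c j / 2) * (f i - f j) ^ 2 =
      (c i * f i) * (c j * f j) - (c i * f i ^ 2 / 2) * c j - c i * (c j * f j ^ 2 / 2) := by
    intro i j; ring
  simp only [e, Finset.sum_sub_distrib, ← Finset.mul_sum, ← Finset.sum_mul, hc]
  ring

/-- For weights summing to zero, the energy quadratic form is a squared `w`-norm. -/
theorem weightedNormSq_sum_cas {d : ℕ} {ι : Type*} (s : Finset ι) (c : ι → ℝ)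
    (hc : ∑ i ∈ s, c i = 0) (x : ι → EuclideanSpace ℝ (Fin d)) :
    weightedNormSq (fun t => ∑ i ∈ s, c i * cas t (x i)) =
      -∑ i ∈ s, ∑ j ∈ s, c i * c j * dist (x i) (x j) := by
  unfold weightedNormSq weightedInner
  simp only [← pow_two, sq_sum_of_sum_eq_zero s c _ hc, Finset.sum_mul, mul_assoc]
  rw [integral_finsetSum]
  · rw [← Finset.sum_neg_distrib]
    refine Finset.sum_congr rfl fun i _ => ?_
    rw [integral_finsetSum, ← Finset.sum_neg_distrib]
    · refine Finset.sum_congr rfl fun j _ => ?_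
      rw [integral_const_mul, integral_cas_sub_sq_mul_energyWeight]
      ring
    · exact fun j _ => (integrable_cas_sub_sq_mul_energyWeight _ _).const_mul _
  · exact fun i _ => integrable_finsetSum _ fun j _ =>
      (integrable_cas_sub_sq_mul_energyWeight _ _).const_mul _

/-! ### Integral functionals from finite-dimensional distributions -/

section Sampling

variable {T Ω Ω' : Type*} [MeasurableSpace T] [MeasurableSpace Ω] [MeasurableSpace Ω']

/-- The mean squared error of the Monte Carlo estimate of `∫ f` by `N` independent points. -/
lemma lintegral_sq_sum_div_sub_integral_le (π : Measure T) [IsProbabilityMeasure π] {N : ℕ}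
    (hN : 0 < N) {f : T → ℝ} (hf : MemLp f 2 π) :
    ∫⁻ u : Fin N → T, ENNReal.ofReal (((∑ j, f (u j)) / N - ∫ t, f t ∂π) ^ 2)
      ∂(Measure.pi fun _ => π) ≤ ENNReal.ofReal ((N : ℝ)⁻¹) * ∫⁻ t, ENNReal.ofReal (f t ^ 2) ∂π := by
  have hN' : (0 : ℝ) < N := by exact_mod_cast hN
  have hmp (j : Fin N) := measurePreserving_eval (fun _ : Fin N => π) j
  have hl (j : Fin N) : MemLp (fun u : Fin N → T => f (u j)) 2 (Measure.pi fun _ => π) :=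
    hf.comp_measurePreserving (hmp j)
  have hsum : MemLp (∑ j, fun u : Fin N → T => f (u j)) 2 (Measure.pi fun _ => π) :=
    memLp_finsetSum' _ fun j _ => hl j
  have hmean : (Measure.pi fun _ : Fin N => π)[∑ j, fun u : Fin N → T => f (u j)] =
      N * ∫ t, f t ∂π := by
    simp only [Finset.sum_apply]
    rw [integral_finsetSum _ fun j _ => (hl j).integrable (by norm_num)]
    have (j : Fin N) : ∫ u : Fin N → T, f (u j) ∂(Measure.pi fun _ => π) = ∫ t, f t ∂π := by
      have h := integral_map (hmp j).measurable.aemeasurable (f := f)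
        (by rw [(hmp j).map_eq]; exact hf.1)
      rw [(hmp j).map_eq] at h
      exact h.symm
    simp [this]
  have hv := variance_sum_pi (ι := Fin N) (Ω := fun _ => T) (μ := fun _ => π) (X := fun _ => f)
    (fun _ => hf)
  rw [variance_eq_integral hsum.1.aemeasurable, hmean] at hv
  have hint : Integrable (fun u : Fin N → T =>
      ((∑ j, fun u : Fin N → T => f (u j)) u - N * ∫ t, f t ∂π) ^ 2) (Measure.pi fun _ => π) :=
    (hsum.sub (memLp_const _)).integrable_sq
  have e : ∀ u : Fin N → T, ((∑ j, f (u j)) / N - ∫ t, f t ∂π) ^ 2 =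
      ((N : ℝ)⁻¹) ^ 2 * (((∑ j, fun u : Fin N → T => f (u j)) u - N * ∫ t, f t ∂π) ^ 2) := by
    intro u
    rw [Finset.sum_apply]
    field_simp
  rw [← ofReal_integral_eq_lintegral_ofReal (by simpa only [e] using hint.const_mul _)
    (ae_of_all _ fun _ => sq_nonneg _), ← ofReal_integral_eq_lintegral_ofReal hf.integrable_sq
    (ae_of_all _ fun _ => sq_nonneg _), ← ENNReal.ofReal_mul (by positivity)]
  apply ENNReal.ofReal_le_ofReal
  simp only [e]
  rw [integral_const_mul, hv]
  have hvar : Var[f; π] ≤ ∫ t, f t ^ 2 ∂π := variance_le_expectation_sq hf.1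
  simp only [Finset.sum_const, Finset.card_univ, Fintype.card_fin, nsmul_eq_mul]
  calc ((N : ℝ)⁻¹) ^ 2 * (N * Var[f; π]) = (N : ℝ)⁻¹ * Var[f; π] := by field_simp
    _ ≤ _ := by gcongr

lemma integrable_of_abs_le {P : Measure Ω} [IsFiniteMeasure P] {f : Ω → ℝ}
    (hf : AEStronglyMeasurable f P) {B : ℝ} (hB : ∀ ω, |f ω| ≤ B) : Integrable f P :=
  .of_bound hf B (ae_of_all _ hB)

lemma measurable_integral_left {π : Measure T} [SFinite π] {F : T → Ω → ℝ}
    (hF : Measurable (Function.uncurry F)) : Measurable fun ω => ∫ t, F t ω ∂π :=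
  (StronglyMeasurable.integral_prod_right' (f := fun p : Ω × T => F p.2 p.1)
    (hF.stronglyMeasurable.comp_measurable measurable_swap)).measurable

/-- Replacing the integral of a process by an average over `N` independent points costs
`O(N^{-1/2})` in the expectation of a Lipschitz function, with a constant that depends only on a bound for the
second moments. -/
lemma abs_integral_sub_integral_sample_le (π : Measure T) [IsProbabilityMeasure π]
    (P : Measure Ω) [IsProbabilityMeasure P] {h : ℝ → ℝ} {B : ℝ} {L : ℝ≥0}
    (hB : ∀ x, |h x| ≤ B) (hL : LipschitzWith L h) {F : T → Ω → ℝ}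
    (hF : Measurable (Function.uncurry F)) {K : ℝ} (hK : 0 ≤ K)
    (hFK : ∀ t, ∫⁻ ω, ENNReal.ofReal (F t ω ^ 2) ∂P ≤ ENNReal.ofReal K)
    {N : ℕ} (hN : 0 < N) {δ : ℝ} (hδ : 0 < δ) :
    |∫ ω, h (∫ t, F t ω ∂π) ∂P -
        ∫ u : Fin N → T, ∫ ω, h ((∑ j, F (u j) ω) / N) ∂P ∂(Measure.pi fun _ => π)| ≤
      L * (δ / 2 + K / (2 * δ * N)) := by
  have hN' : (0 : ℝ) < N := by exact_mod_cast hN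
  have hhm : Measurable h := hL.continuous.measurable
  have hm := measurable_integral_left (π := π) hF
  have hF' (j : Fin N) : Measurable fun p : (Fin N → T) × Ω => F (p.1 j) p.2 :=
    hF.comp (g := Function.uncurry F) (f := fun p : (Fin N → T) × Ω => (p.1 j, p.2))
        (((measurable_pi_apply j).comp measurable_fst).prodMk measurable_snd)
  have hS : Measurable fun p : (Fin N → T) × Ω => (∑ j, F (p.1 j) p.2) / N := by fun_prop
  set ρ : Measure ((Fin N → T) × Ω) := (Measure.pi fun _ => π).prod P with hρ
  have i1 : Integrable (fun p : (Fin N → T) × Ω => h ((∑ j, F (p.1 j) p.2) / N)) ρ :=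
    integrable_of_abs_le (hhm.comp hS).aestronglyMeasurable fun p => hB _
  have hm2 : Measurable fun p : (Fin N → T) × Ω => h (∫ t, F t p.2 ∂π) :=
    hhm.comp (hm.comp measurable_snd)
  have i2 : Integrable (fun p : (Fin N → T) × Ω => h (∫ t, F t p.2 ∂π)) ρ :=
    integrable_of_abs_le hm2.aestronglyMeasurable fun p => hB _
  have e2 : ∫ ω, h (∫ t, F t ω ∂π) ∂P = ∫ p, h (∫ t, F t p.2 ∂π) ∂ρ := by
    rw [hρ, integral_prod _ i2]; simp
  have hsm : Measurable fun p : (Fin N → T) × Ω =>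
      ((∑ j, F (p.1 j) p.2) / N - ∫ t, F t p.2 ∂π) ^ 2 :=
    (hS.sub (hm.comp measurable_snd)).pow_const 2
  have hsq : ∫⁻ p, ENNReal.ofReal (((∑ j, F (p.1 j) p.2) / N - ∫ t, F t p.2 ∂π) ^ 2) ∂ρ ≤
      ENNReal.ofReal (K / N) := by
    rw [hρ, lintegral_prod_symm _ hsm.ennreal_ofReal.aemeasurable]
    have hfin : ∫⁻ ω, ∫⁻ t, ENNReal.ofReal (F t ω ^ 2) ∂π ∂P ≤ ENNReal.ofReal K := by
      rw [lintegral_lintegral_swap]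
      · calc ∫⁻ t, ∫⁻ ω, ENNReal.ofReal (F t ω ^ 2) ∂P ∂π ≤ ∫⁻ _, ENNReal.ofReal K ∂π :=
            lintegral_mono fun t => hFK t
          _ = _ := by simp
      · exact (ENNReal.measurable_ofReal.comp
          ((hF.comp measurable_swap).pow_const 2)).aemeasurable
    have hmeas : Measurable fun ω => ∫⁻ t, ENNReal.ofReal (F t ω ^ 2) ∂π := by
      apply Measurable.lintegral_prod_right' (f := fun p : Ω × T => ENNReal.ofReal (F p.2 p.1 ^ 2))
      exact ENNReal.measurable_ofReal.comp ((hF.comp measurable_swap).pow_const 2)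
    have hae : ∀ᵐ ω ∂P, ∫⁻ t, ENNReal.ofReal (F t ω ^ 2) ∂π < ∞ :=
      ae_lt_top hmeas (ne_top_of_le_ne_top ENNReal.ofReal_ne_top hfin)
    calc _ ≤ ∫⁻ ω, ENNReal.ofReal ((N : ℝ)⁻¹) * ∫⁻ t, ENNReal.ofReal (F t ω ^ 2) ∂π ∂P := by
          refine lintegral_mono_ae ?_
          filter_upwards [hae] with ω hω
          have hFm : Measurable fun t => F t ω := hF.comp measurable_prodMk_right
          refine lintegral_sq_sum_div_sub_integral_le (f := fun t => F t ω) π hN ?_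
          rw [memLp_two_iff_integrable_sq hFm.aestronglyMeasurable]
          refine ⟨(hFm.pow_const 2).aestronglyMeasurable, ?_⟩
          rwa [hasFiniteIntegral_iff_ofReal (ae_of_all _ fun t => sq_nonneg _)]
      _ ≤ ENNReal.ofReal ((N : ℝ)⁻¹) * ENNReal.ofReal K := by
          rw [lintegral_const_mul _ hmeas]
          gcongr
      _ = _ := by
          rw [← ENNReal.ofReal_mul (by positivity)]; congr 1; field_simp
  have isq : Integrable (fun p : (Fin N → T) × Ω =>
      ((∑ j, F (p.1 j) p.2) / N - ∫ t, F t p.2 ∂π) ^ 2) ρ := by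
    refine ⟨hsm.aestronglyMeasurable, ?_⟩
    rw [hasFiniteIntegral_iff_ofReal (ae_of_all _ fun t => sq_nonneg _)]
    exact hsq.trans_lt ENNReal.ofReal_lt_top
  have hsq' : ∫ p, ((∑ j, F (p.1 j) p.2) / N - ∫ t, F t p.2 ∂π) ^ 2 ∂ρ ≤ K / N := by
    rw [← ofReal_integral_eq_lintegral_ofReal isq (ae_of_all _ fun t => sq_nonneg _)] at hsq
    exact (ENNReal.ofReal_le_ofReal_iff (by positivity)).1 hsq
  have hprod : ∫ u : Fin N → T, ∫ ω, h ((∑ j, F (u j) ω) / N) ∂P ∂(Measure.pi fun _ => π) =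
      ∫ p, h ((∑ j, F (p.1 j) p.2) / N) ∂ρ := by
    rw [hρ, integral_prod _ i1]
  rw [e2, hprod, ← integral_sub i2 i1]
  refine (abs_integral_le_integral_abs).trans ?_
  calc ∫ p, |h (∫ t, F t p.2 ∂π) - h ((∑ j, F (p.1 j) p.2) / N)| ∂ρ
      ≤ ∫ p, L * (δ / 2 + (2 * δ)⁻¹ * ((∑ j, F (p.1 j) p.2) / N - ∫ t, F t p.2 ∂π) ^ 2) ∂ρ := by
        refine integral_mono (i2.sub i1).abs
          (((integrable_const _).add (isq.const_mul _)).const_mul _) fun p => ?_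
        have h1 := hL.dist_le_mul (∫ t, F t p.2 ∂π) ((∑ j, F (p.1 j) p.2) / N)
        rw [Real.dist_eq, Real.dist_eq, abs_sub_comm (∫ t, F t p.2 ∂π)] at h1
        refine h1.trans (mul_le_mul_of_nonneg_left ?_ L.coe_nonneg)
        generalize (∑ j, F (p.1 j) p.2) / N - ∫ t, F t p.2 ∂π = x
        have : (2 * δ)⁻¹ * x ^ 2 = |x| ^ 2 / (2 * δ) := by rw [sq_abs]; field_simp
        rw [this, div_add_div _ _ (by norm_num) (by positivity), le_div_iff₀ (by positivity)]
        nlinarith [sq_nonneg (|x| - δ)]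
    _ = L * (δ / 2 + (2 * δ)⁻¹ *
          ∫ p, ((∑ j, F (p.1 j) p.2) / N - ∫ t, F t p.2 ∂π) ^ 2 ∂ρ) := by
        rw [integral_const_mul, integral_add (integrable_const _) (isq.const_mul _),
          integral_const_mul]
        simp
    _ ≤ L * (δ / 2 + (2 * δ)⁻¹ * (K / N)) := by gcongr
    _ = _ := by congr 2; field_simp

variable {P : Measure Ω} [IsProbabilityMeasure P] {P' : Measure Ω'} [IsProbabilityMeasure P']
  {F : ℕ → T → Ω → ℝ} {G : T → Ω' → ℝ} {K : ℝ}

/-- By `abs_integral_sub_integral_sample_le`, uniformly in `k`, and dominated convergence over the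
sampled points. -/
lemma tendsto_integral_of_tendsto_sample (π : Measure T) [IsProbabilityMeasure π]
    (hF : ∀ k, Measurable (Function.uncurry (F k))) (hG : Measurable (Function.uncurry G))
    (hFK : ∀ k t, ∫⁻ ω, ENNReal.ofReal (F k t ω ^ 2) ∂P ≤ ENNReal.ofReal K)
    (hGK : ∀ t, ∫⁻ ω, ENNReal.ofReal (G t ω ^ 2) ∂P' ≤ ENNReal.ofReal K) (hK : 0 ≤ K)
    {h : ℝ → ℝ} {B : ℝ} {L : ℝ≥0} (hB : ∀ x, |h x| ≤ B) (hL : LipschitzWith L h)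
    (hfd : ∀ (N : ℕ) (u : Fin N → T), Tendsto (fun k => ∫ ω, h ((∑ j, F k (u j) ω) / N) ∂P) atTop
      (𝓝 (∫ ω, h ((∑ j, G (u j) ω) / N) ∂P'))) :
    Tendsto (fun k => ∫ ω, h (∫ t, F k t ω ∂π) ∂P) atTop (𝓝 (∫ ω, h (∫ t, G t ω ∂π) ∂P')) := by
  have hhm : Measurable h := hL.continuous.measurable
  rw [Metric.tendsto_atTop]
  intro ε hε
  obtain ⟨δ, hδ, hδε⟩ : ∃ δ > 0, L * (δ / 2) < ε / 6 := by
    refine ⟨ε / (6 * (L + 1)), by positivity, ?_⟩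
    rw [← mul_div_assoc, mul_div_assoc', div_div, div_lt_div_iff₀ (by positivity) (by positivity)]
    nlinarith [L.coe_nonneg, mul_nonneg L.coe_nonneg hε.le]
  obtain ⟨N, hN, hNε⟩ : ∃ N : ℕ, 0 < N ∧ L * (K / (2 * δ * N)) < ε / 6 := by
    have : Tendsto (fun N : ℕ => L * (K / (2 * δ)) / N) atTop (𝓝 0) :=
      tendsto_const_div_atTop_nhds_zero_nat _
    obtain ⟨N, h1, h2⟩ := ((this.eventually_lt_const (by positivity : 0 < ε / 6)).and
      (eventually_gt_atTop 0)).exists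
    refine ⟨N, h2, ?_⟩
    rwa [← div_div, ← mul_div_assoc]
  have herr : L * (δ / 2 + K / (2 * δ * N)) < ε / 3 := by rw [mul_add]; linarith
  have hS (k : ℕ) : Measurable fun p : (Fin N → T) × Ω => h ((∑ j, F k (p.1 j) p.2) / N) := by
    have (j : Fin N) : Measurable fun p : (Fin N → T) × Ω => F k (p.1 j) p.2 :=
      (hF k).comp (g := Function.uncurry (F k)) (f := fun p : (Fin N → T) × Ω => (p.1 j, p.2))
        (((measurable_pi_apply j).comp measurable_fst).prodMk measurable_snd)
    fun_prop
  have hmid : Tendsto (fun k => ∫ u : Fin N → T, ∫ ω, h ((∑ j, F k (u j) ω) / N) ∂P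
      ∂(Measure.pi fun _ => π)) atTop (𝓝 (∫ u : Fin N → T, ∫ ω, h ((∑ j, G (u j) ω) / N) ∂P'
      ∂(Measure.pi fun _ => π))) := by
    refine tendsto_integral_of_dominated_convergence (fun _ => B) (fun k => ?_)
      (integrable_const _) (fun k => ae_of_all _ fun u => ?_) (ae_of_all _ fun u => hfd N u)
    · exact (hS k).stronglyMeasurable.integral_prod_right.aestronglyMeasurable
    · refine (norm_integral_le_of_norm_le_const (ae_of_all _ fun ω => hB _)).trans ?_
      simp
  obtain ⟨k₀, hk₀⟩ := Metric.tendsto_atTop.1 hmid (ε / 3) (by positivity)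
  refine ⟨k₀, fun k hk => ?_⟩
  have h1 := abs_integral_sub_integral_sample_le π P hB hL (hF k) hK (hFK k) hN hδ
  have h2 := abs_integral_sub_integral_sample_le π P' hB hL hG hK hGK hN hδ
  have h3 := hk₀ k hk
  rw [Real.dist_eq, abs_lt] at *
  rw [abs_le] at h1 h2
  constructor <;> linarith [h1.1, h1.2, h2.1, h2.2, h3.1, h3.2]

lemma tendsto_integral_of_tendsto_sample_of_isFiniteMeasure (ν : Measure T) [IsFiniteMeasure ν]
    (hF : ∀ k, Measurable (Function.uncurry (F k))) (hG : Measurable (Function.uncurry G))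
    (hFK : ∀ k t, ∫⁻ ω, ENNReal.ofReal (F k t ω ^ 2) ∂P ≤ ENNReal.ofReal K)
    (hGK : ∀ t, ∫⁻ ω, ENNReal.ofReal (G t ω ^ 2) ∂P' ≤ ENNReal.ofReal K) (hK : 0 ≤ K)
    (hfd : ∀ (h : ℝ → ℝ) (B : ℝ) (L : ℝ≥0), (∀ x, |h x| ≤ B) → LipschitzWith L h →
      ∀ (N : ℕ) (u : Fin N → T), Tendsto (fun k => ∫ ω, h ((∑ j, F k (u j) ω) / N) ∂P) atTop
      (𝓝 (∫ ω, h ((∑ j, G (u j) ω) / N) ∂P')))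
    {h : ℝ → ℝ} {B : ℝ} {L : ℝ≥0} (hB : ∀ x, |h x| ≤ B) (hL : LipschitzWith L h) :
    Tendsto (fun k => ∫ ω, h (∫ t, F k t ω ∂ν) ∂P) atTop (𝓝 (∫ ω, h (∫ t, G t ω ∂ν) ∂P')) := by
  rcases eq_or_ne ν 0 with rfl | hν
  · simp
  have : NeZero ν := ⟨hν⟩
  have hM : (ν Set.univ).toReal ≠ 0 :=
    ENNReal.toReal_ne_zero.2 ⟨by simpa using hν, measure_ne_top _ _⟩
  have hL' : LipschitzWith (L * ‖(ν Set.univ).toReal‖₊) fun x => h ((ν Set.univ).toReal * x) :=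
    hL.comp (LipschitzWith.of_dist_le_mul fun x y => by
      rw [dist_eq_norm, dist_eq_norm, ← mul_sub, norm_mul, coe_nnnorm])
  have key := tendsto_integral_of_tendsto_sample ((ν Set.univ)⁻¹ • ν) hF hG hFK hGK hK
    (h := fun x => h ((ν Set.univ).toReal * x)) (fun x => hB _) hL'
    (fun N u => hfd _ B _ (fun x => hB _) hL' N u)
  simpa [integral_smul_measure, ENNReal.toReal_inv, ← mul_assoc, hM] using key

/-- Cutting the domain of integration costs at most the integral of the absolute moments. -/
lemma abs_integral_sub_integral_restrict_le (ν : Measure T) [SigmaFinite ν] {G : T → Ω → ℝ}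
    (hG : Measurable (Function.uncurry G)) {b : T → ℝ≥0∞}
    (hb : ∫⁻ t, b t ∂ν ≠ ∞) (hGb : ∀ t, ∫⁻ ω, ‖G t ω‖ₑ ∂P ≤ b t)
    {h : ℝ → ℝ} {B : ℝ} {L : ℝ≥0} (hB : ∀ x, |h x| ≤ B) (hL : LipschitzWith L h)
    {A : Set T} (hA : MeasurableSet A) :
    |∫ ω, h (∫ t, G t ω ∂ν) ∂P - ∫ ω, h (∫ t in A, G t ω ∂ν) ∂P| ≤
      L * (∫⁻ t in Aᶜ, b t ∂ν).toReal := by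
  have hhm : Measurable h := hL.continuous.measurable
  have i1 : Integrable (fun ω => h (∫ t, G t ω ∂ν)) P :=
    integrable_of_abs_le (hhm.comp (measurable_integral_left hG)).aestronglyMeasurable
      fun _ => hB _
  have i2 : Integrable (fun ω => h (∫ t in A, G t ω ∂ν)) P :=
    integrable_of_abs_le (hhm.comp (measurable_integral_left hG)).aestronglyMeasurable
      fun _ => hB _
  have hswap (ν' : Measure T) [SFinite ν'] :
      ∫⁻ ω, ∫⁻ t, ‖G t ω‖ₑ ∂ν' ∂P ≤ ∫⁻ t, b t ∂ν' := by
    rw [lintegral_lintegral_swap]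
    · exact lintegral_mono hGb
    · exact (hG.comp measurable_swap).enorm.aemeasurable
  have hmeas (ν' : Measure T) [SFinite ν'] : Measurable fun ω => ∫⁻ t, ‖G t ω‖ₑ ∂ν' :=
    Measurable.lintegral_prod_right' (f := fun p : Ω × T => ‖G p.2 p.1‖ₑ)
      (hG.comp measurable_swap).enorm
  have hae : ∀ᵐ ω ∂P, ∫⁻ t, ‖G t ω‖ₑ ∂ν < ∞ :=
    ae_lt_top (hmeas ν) (ne_top_of_le_ne_top hb (hswap ν))
  have hfin : ∫⁻ t in Aᶜ, b t ∂ν ≠ ∞ := ne_top_of_le_ne_top hb (setLIntegral_le_lintegral _ _)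
  rw [← integral_sub i1 i2, ← Real.norm_eq_abs,
    show (L : ℝ) * (∫⁻ t in Aᶜ, b t ∂ν).toReal = (L * ∫⁻ t in Aᶜ, b t ∂ν).toReal by
      rw [ENNReal.toReal_mul]; simp,
    ← toReal_enorm]
  refine ENNReal.toReal_mono (ENNReal.mul_ne_top ENNReal.coe_ne_top hfin) ?_
  refine (enorm_integral_le_lintegral_enorm _).trans ?_
  calc ∫⁻ ω, ‖h (∫ t, G t ω ∂ν) - h (∫ t in A, G t ω ∂ν)‖ₑ ∂P
      ≤ ∫⁻ ω, L * ∫⁻ t in Aᶜ, ‖G t ω‖ₑ ∂ν ∂P := by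
        refine lintegral_mono_ae ?_
        filter_upwards [hae] with ω hω
        have hi : Integrable (fun t => G t ω) ν :=
          ⟨(hG.comp measurable_prodMk_right).aestronglyMeasurable, hω⟩
        rw [← edist_eq_enorm_sub]
        refine (hL _ _).trans ?_
        gcongr
        rw [edist_eq_enorm_sub, ← integral_add_compl hA hi, add_sub_cancel_left]
        exact enorm_integral_le_lintegral_enorm _
    _ = L * ∫⁻ ω, ∫⁻ t in Aᶜ, ‖G t ω‖ₑ ∂ν ∂P := lintegral_const_mul _ (hmeas _)
    _ ≤ _ := by gcongr; exact hswap _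

/-- **Convergence in distribution of integral functionals.** If averages of the processes `F k` over
finitely many points converge in distribution to those of `G`, the second moments are bounded and
the absolute first moments have a common integrable bound, then the integrals converge in
distribution. -/
theorem tendsto_integral_integral_of_tendsto_average (ν : Measure T) [SigmaFinite ν]
    (hF : ∀ k, Measurable (Function.uncurry (F k))) (hG : Measurable (Function.uncurry G))
    (hFK : ∀ k t, ∫⁻ ω, ENNReal.ofReal (F k t ω ^ 2) ∂P ≤ ENNReal.ofReal K)
    (hGK : ∀ t, ∫⁻ ω, ENNReal.ofReal (G t ω ^ 2) ∂P' ≤ ENNReal.ofReal K) (hK : 0 ≤ K)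
    {b : T → ℝ≥0∞} (hb : ∫⁻ t, b t ∂ν ≠ ∞)
    (hFb : ∀ k t, ∫⁻ ω, ‖F k t ω‖ₑ ∂P ≤ b t) (hGb : ∀ t, ∫⁻ ω, ‖G t ω‖ₑ ∂P' ≤ b t)
    (hfd : ∀ (h : ℝ → ℝ) (B : ℝ) (L : ℝ≥0), (∀ x, |h x| ≤ B) → LipschitzWith L h →
      ∀ (N : ℕ) (u : Fin N → T), Tendsto (fun k => ∫ ω, h ((∑ j, F k (u j) ω) / N) ∂P) atTop
      (𝓝 (∫ ω, h ((∑ j, G (u j) ω) / N) ∂P')))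
    {h : ℝ → ℝ} {B : ℝ} {L : ℝ≥0} (hB : ∀ x, |h x| ≤ B) (hL : LipschitzWith L h) :
    Tendsto (fun k => ∫ ω, h (∫ t, F k t ω ∂ν) ∂P) atTop (𝓝 (∫ ω, h (∫ t, G t ω ∂ν) ∂P')) := by
  have htail : Tendsto (fun n => L * (∫⁻ t in (spanningSets ν n)ᶜ, b t ∂ν).toReal) atTop
      (𝓝 0) := by
    have h0 : Tendsto (fun n => (ν.withDensity b) (spanningSets ν n)ᶜ) atTop
        (𝓝 ((ν.withDensity b) (⋂ n, (spanningSets ν n)ᶜ))) := by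
      refine tendsto_measure_iInter_atTop
        (fun n => (measurableSet_spanningSets ν n).compl.nullMeasurableSet)
        (fun i j hij => Set.compl_subset_compl.2 (monotone_spanningSets ν hij)) ⟨0, ?_⟩
      rw [withDensity_apply _ (measurableSet_spanningSets ν 0).compl]
      exact ne_top_of_le_ne_top hb (setLIntegral_le_lintegral _ _)
    rw [← Set.compl_iUnion, iUnion_spanningSets, Set.compl_univ, measure_empty] at h0
    have h1 := (ENNReal.tendsto_toReal ENNReal.zero_ne_top).comp h0
    have h2 := h1.const_mul (L : ℝ)
    simp only [ENNReal.toReal_zero, mul_zero] at h2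
    refine h2.congr fun n => ?_
    simp [withDensity_apply _ (measurableSet_spanningSets ν n).compl]
  rw [Metric.tendsto_atTop]
  intro ε hε
  obtain ⟨n, hn⟩ := (htail.eventually_lt_const (by positivity : 0 < ε / 3)).exists
  have hA := measurableSet_spanningSets ν n
  have : IsFiniteMeasure (ν.restrict (spanningSets ν n)) :=
    isFiniteMeasure_restrict.2 (measure_spanningSets_lt_top ν n).ne
  obtain ⟨k₀, hk₀⟩ := Metric.tendsto_atTop.1 (tendsto_integral_of_tendsto_sample_of_isFiniteMeasure
    (ν.restrict (spanningSets ν n)) hF hG hFK hGK hK hfd hB hL) (ε / 3) (by positivity)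
  refine ⟨k₀, fun k hk => ?_⟩
  have h1 := abs_integral_sub_integral_restrict_le ν (hF k) hb (hFb k) hB hL hA
  have h2 := abs_integral_sub_integral_restrict_le ν hG hb hGb hB hL hA
  have h3 := hk₀ k hk
  rw [Real.dist_eq, abs_lt] at *
  rw [abs_le] at h1 h2
  constructor <;> linarith [h1.1, h1.2, h2.1, h2.2, h3.1, h3.2]

end Sampling

/-! ### The central limit theorem for weighted sums -/

lemma norm_prod_sub_prod_le_sum {ι : Type*} (s : Finset ι) {a b : ι → ℂ} (ha : ∀ i, ‖a i‖ ≤ 1)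
    (hb : ∀ i, ‖b i‖ ≤ 1) : ‖∏ i ∈ s, a i - ∏ i ∈ s, b i‖ ≤ ∑ i ∈ s, ‖a i - b i‖ := by
  classical
  induction s using Finset.induction_on with
  | empty => simp
  | insert i s hi ih =>
    rw [Finset.prod_insert hi, Finset.prod_insert hi, Finset.sum_insert hi]
    have hB : ‖∏ i ∈ s, b i‖ ≤ 1 := by
      rw [norm_prod]; exact Finset.prod_le_one (fun _ _ => norm_nonneg _) fun i _ => hb i
    calc ‖a i * ∏ i ∈ s, a i - b i * ∏ i ∈ s, b i‖
        = ‖a i * (∏ i ∈ s, a i - ∏ i ∈ s, b i) + (a i - b i) * ∏ i ∈ s, b i‖ := by ring_nf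
      _ ≤ ‖a i‖ * ‖∏ i ∈ s, a i - ∏ i ∈ s, b i‖ + ‖a i - b i‖ * ‖∏ i ∈ s, b i‖ := by
          rw [← norm_mul, ← norm_mul]; exact norm_add_le _ _
      _ ≤ 1 * (∑ i ∈ s, ‖a i - b i‖) + ‖a i - b i‖ * 1 := by
          gcongr
          exact ha i
      _ = _ := by ring

lemma isLittleO_charFun_sub_taylor {ν : Measure ℝ} [IsProbabilityMeasure ν] (h2 : MemLp id 2 ν)
    (h0 : ∫ x, x ∂ν = 0) :
    (fun t : ℝ => charFun ν t - (1 - (∫ x, x ^ 2 ∂ν : ℝ) * (t : ℂ) ^ 2 / 2)) =o[𝓝 0]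
      fun t : ℝ => t ^ 2 := by
  have h := taylor_isLittleO_univ (x₀ := 0) (contDiff_charFun (n := 2) (μ := ν) (by exact_mod_cast h2))
  have e : ∀ t : ℝ, taylorWithinEval (charFun ν) 2 Set.univ 0 t =
      1 - (∫ x, x ^ 2 ∂ν : ℝ) * (t : ℂ) ^ 2 / 2 := by
    intro t
    have := taylorWithinEval_charFun_two_zero (P := ν) (X := id) aemeasurable_id
      (by simpa using h2) t
    rw [Measure.map_id] at this
    rw [this]
    simp [h0]
  simpa only [e, sub_zero] using h

/-- A characteristic function agrees to second order with the Gaussian one of the same variance. -/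
lemma isLittleO_charFun_sub_gaussian {ν : Measure ℝ} [IsProbabilityMeasure ν] (h2 : MemLp id 2 ν)
    (h0 : ∫ x, x ∂ν = 0) :
    (fun t : ℝ => charFun ν t - Complex.exp (-((∫ x, x ^ 2 ∂ν : ℝ) * (t : ℂ) ^ 2 / 2))) =o[𝓝 0]
      fun t : ℝ => t ^ 2 := by
  obtain ⟨v, hv⟩ : ∃ v : ℝ≥0, (v : ℝ) = ∫ x, x ^ 2 ∂ν :=
    ⟨⟨_, integral_nonneg fun x => sq_nonneg x⟩, rfl⟩
  have hg := isLittleO_charFun_sub_taylor (ν := gaussianReal 0 v) (memLp_id_gaussianReal 2)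
    integral_id_gaussianReal
  have hvar : ∫ x, x ^ 2 ∂(gaussianReal 0 v) = v := by
    have h := variance_fun_id_gaussianReal (μ := 0) (v := v)
    rw [variance_eq_integral aemeasurable_id'] at h
    simpa [integral_id_gaussianReal] using h
  rw [hvar] at hg
  refine ((isLittleO_charFun_sub_taylor h2 h0).sub hg).congr_left fun t => ?_
  rw [charFun_gaussianReal, ← hv]
  simp

/-- Arrays of weights, indexed by the finite sets `s k`, that sum to zero, have unit sum of squares,
and are asymptotically negligible. -/
structure IsNegligibleContrast {ι : Type*} (s : ℕ → Finset ι) (c : ℕ → ι → ℝ) : Prop where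
  sum_eq_zero : ∀ k, ∑ i ∈ s k, c k i = 0
  sum_sq_eq_one : ∀ k, ∑ i ∈ s k, c k i ^ 2 = 1
  eventually_abs_le : ∀ δ > 0, ∀ᶠ k in atTop, ∀ i ∈ s k, |c k i| ≤ δ

/-- The central limit theorem for an i.i.d. sequence with negligible weights, in terms of
characteristic functions. -/
lemma IsNegligibleContrast.tendsto_prod_charFun {ι : Type*} {s : ℕ → Finset ι} {c : ℕ → ι → ℝ}
    (hc : IsNegligibleContrast s c) {ν : Measure ℝ} [IsProbabilityMeasure ν] (h2 : MemLp id 2 ν)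
    (h0 : ∫ x, x ∂ν = 0) :
    Tendsto (fun k => ∏ i ∈ s k, charFun ν (c k i)) atTop
      (𝓝 (Complex.exp (-((∫ x, x ^ 2 ∂ν : ℝ) / 2)))) := by
  set v := ∫ x, x ^ 2 ∂ν with hv
  have hv0 : 0 ≤ v := integral_nonneg fun x => sq_nonneg x
  have hexp : ∀ k, Complex.exp (-((v : ℂ) / 2)) =
      ∏ i ∈ s k, Complex.exp (-((v : ℂ) * (c k i : ℂ) ^ 2 / 2)) := by
    intro k
    rw [← Complex.exp_sum, Finset.sum_neg_distrib, ← Finset.sum_div, ← Finset.mul_sum]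
    have := congrArg (fun x : ℝ => (x : ℂ)) (hc.sum_sq_eq_one k)
    push_cast at this
    rw [this, mul_one]
  rw [Metric.tendsto_atTop]
  intro ε hε
  have hlo := (isLittleO_charFun_sub_gaussian h2 h0).def (half_pos hε)
  obtain ⟨δ, hδ, hball⟩ := Metric.eventually_nhds_iff.1 hlo
  obtain ⟨k₀, hk₀⟩ := eventually_atTop.1 (hc.eventually_abs_le (δ / 2) (half_pos hδ))
  refine ⟨k₀, fun k hk => ?_⟩
  rw [dist_eq_norm, hexp k]
  have hb : ∀ i, ‖Complex.exp (-((v : ℂ) * (c k i : ℂ) ^ 2 / 2))‖ ≤ 1 := by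
    intro i
    rw [show -((v : ℂ) * (c k i : ℂ) ^ 2 / 2) = ((-(v * c k i ^ 2 / 2) : ℝ) : ℂ) by push_cast; ring,
      ← Complex.ofReal_exp, Complex.norm_real, Real.norm_of_nonneg (Real.exp_pos _).le]
    exact Real.exp_le_one_iff.2 (neg_nonpos.2 (by positivity))
  calc _ ≤ ∑ i ∈ s k, ‖charFun ν (c k i) - Complex.exp (-((v : ℂ) * (c k i : ℂ) ^ 2 / 2))‖ :=
        norm_prod_sub_prod_le_sum _ (fun i => norm_charFun_le_one _) hb
    _ ≤ ∑ i ∈ s k, ε / 2 * c k i ^ 2 := by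
        refine Finset.sum_le_sum fun i hi => ?_
        have := hball (y := c k i) (by
          rw [dist_zero_right, Real.norm_eq_abs]; linarith [hk₀ k hk i hi])
        simpa [← hv] using this
    _ < ε := by rw [← Finset.mul_sum, hc.sum_sq_eq_one]; linarith

/-! ### Fourth moments -/

lemma pow_four_le_exp_add_exp (x : ℝ) : x ^ 4 ≤ 24 * (Real.exp x + Real.exp (-x)) := by
  have h := Real.pow_div_factorial_le_exp |x| (abs_nonneg x) 4
  have h4 : |x| ^ 4 = x ^ 4 := by
    rw [show (4 : ℕ) = 2 * 2 by norm_num, pow_mul, sq_abs, ← pow_mul]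
  have h5 : Real.exp |x| ≤ Real.exp x + Real.exp (-x) := by
    rcases abs_cases x with ⟨h, -⟩ | ⟨h, -⟩ <;> rw [h] <;>
      linarith [Real.exp_pos x, Real.exp_pos (-x)]
  rw [h4, show ((Nat.factorial 4 : ℕ) : ℝ) = 24 by norm_num [Nat.factorial],
    div_le_iff₀ (by norm_num)] at h
  linarith

lemma lintegral_pow_four_le_of_hasSubgaussianMGF {Ω : Type*} [MeasurableSpace Ω] {P : Measure Ω}
    {X : Ω → ℝ} {c : ℝ≥0} (h : HasSubgaussianMGF X c P) :
    ∫⁻ ω, ENNReal.ofReal ((X ω ^ 2) ^ 2) ∂P ≤ ENNReal.ofReal (48 * Real.exp (c / 2)) := by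
  have i1 : Integrable (fun ω => Real.exp (X ω)) P := by simpa using h.integrable_exp_mul 1
  have i2 : Integrable (fun ω => Real.exp (-X ω)) P := by simpa using h.integrable_exp_mul (-1)
  have m1 : ∫ ω, Real.exp (X ω) ∂P ≤ Real.exp (c / 2) := by
    simpa [mgf] using h.mgf_le 1
  have m2 : ∫ ω, Real.exp (-X ω) ∂P ≤ Real.exp (c / 2) := by
    simpa [mgf] using h.mgf_le (-1)
  calc ∫⁻ ω, ENNReal.ofReal ((X ω ^ 2) ^ 2) ∂P
      ≤ ∫⁻ ω, ENNReal.ofReal (24 * (Real.exp (X ω) + Real.exp (-X ω))) ∂P := by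
        refine lintegral_mono fun ω => ENNReal.ofReal_le_ofReal ?_
        rw [← pow_mul]
        exact pow_four_le_exp_add_exp _
    _ = ENNReal.ofReal (24 * (∫ ω, Real.exp (X ω) ∂P + ∫ ω, Real.exp (-X ω) ∂P)) := by
        rw [← integral_add i1 i2, ← integral_const_mul, ofReal_integral_eq_lintegral_ofReal]
        · exact (i1.add i2).const_mul _
        · exact ae_of_all _ fun ω => by positivity
    _ ≤ _ := ENNReal.ofReal_le_ofReal (by linarith)

lemma hasSubgaussianMGF_of_map_eq_gaussianReal {Ω : Type*} [MeasurableSpace Ω] {P : Measure Ω}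
    {X : Ω → ℝ} {v : ℝ≥0} (hX : AEMeasurable X P) (h : P.map X = gaussianReal 0 v) :
    HasSubgaussianMGF X v P where
  integrable_exp_mul t := by
    have := integrable_exp_mul_gaussianReal (μ := 0) (v := v) t
    rw [← h] at this
    exact this.comp_aemeasurable hX
  mgf_le t := by rw [mgf_gaussianReal h]; simp

/-! ### Centered features and the limit covariance -/

section Features

variable {d : ℕ} (μ : Measure (EuclideanSpace ℝ (Fin d)))

/-- The function `cas t`, centered under `μ`. -/
noncomputable def centeredCas (t x : EuclideanSpace ℝ (Fin d)) : ℝ :=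
  cas t x - ∫ y, cas t y ∂μ

lemma measurable_cas_right (t : EuclideanSpace ℝ (Fin d)) : Measurable (cas t) := by
  unfold cas; fun_prop

lemma measurable_centeredCas_right (t : EuclideanSpace ℝ (Fin d)) :
    Measurable (centeredCas μ t) :=
  (measurable_cas_right t).sub_const _

variable [IsProbabilityMeasure μ]

@[fun_prop]
lemma measurable_centeredCas :
    Measurable fun p : EuclideanSpace ℝ (Fin d) × EuclideanSpace ℝ (Fin d) =>
      centeredCas μ p.1 p.2 := by
  have h : Measurable fun t : EuclideanSpace ℝ (Fin d) => ∫ y, cas t y ∂μ :=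
    (StronglyMeasurable.integral_prod_right' (f := fun p : EuclideanSpace ℝ (Fin d) ×
      EuclideanSpace ℝ (Fin d) => cas p.1 p.2) measurable_cas.stronglyMeasurable).measurable
  exact measurable_cas.sub (h.comp measurable_fst)

lemma integrable_cas (t : EuclideanSpace ℝ (Fin d)) : Integrable (cas t) μ :=
  integrable_of_abs_le (measurable_cas_right t).aestronglyMeasurable (abs_cas_le t)

lemma abs_centeredCas_le (t x : EuclideanSpace ℝ (Fin d)) : |centeredCas μ t x| ≤ 4 := by
  have h1 : |∫ y, cas t y ∂μ| ≤ 2 := by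
    refine (norm_integral_le_of_norm_le_const (f := cas t) (ae_of_all μ (abs_cas_le t))).trans ?_
    simp
  have h2 := abs_cas_le t x
  unfold centeredCas
  rw [abs_le] at *
  constructor <;> linarith [h1.1, h1.2, h2.1, h2.2]

lemma integrable_centeredCas (t : EuclideanSpace ℝ (Fin d)) : Integrable (centeredCas μ t) μ :=
  (integrable_cas μ t).sub (integrable_const _)

lemma integral_centeredCas (t : EuclideanSpace ℝ (Fin d)) : ∫ x, centeredCas μ t x ∂μ = 0 := by
  unfold centeredCas
  rw [integral_sub (integrable_cas μ t) (integrable_const _)]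
  simp

lemma integrable_centeredCas_mul (s t : EuclideanSpace ℝ (Fin d)) :
    Integrable (fun x => centeredCas μ s x * centeredCas μ t x) μ :=
  integrable_of_abs_le ((measurable_centeredCas_right μ s).mul
    (measurable_centeredCas_right μ t)).aestronglyMeasurable (B := 4 * 4) fun x => by
      rw [abs_mul]
      exact mul_le_mul (abs_centeredCas_le μ s x) (abs_centeredCas_le μ t x) (abs_nonneg _)
        (by norm_num)

lemma integrable_cos_inner (t : EuclideanSpace ℝ (Fin d)) :
    Integrable (fun x => Real.cos ⟪x, t⟫) μ :=
  integrable_of_abs_le (by fun_prop) fun x => Real.abs_cos_le_one _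

lemma integrable_sin_inner (t : EuclideanSpace ℝ (Fin d)) :
    Integrable (fun x => Real.sin ⟪x, t⟫) μ :=
  integrable_of_abs_le (by fun_prop) fun x => Real.abs_sin_le_one _

lemma charFun_re_im (t : EuclideanSpace ℝ (Fin d)) :
    (charFun μ t).re = ∫ x, Real.cos ⟪x, t⟫ ∂μ ∧ (charFun μ t).im = ∫ x, Real.sin ⟪x, t⟫ ∂μ := by
  have hi : Integrable (fun x : EuclideanSpace ℝ (Fin d) => Complex.exp (⟪x, t⟫ * Complex.I)) μ :=
    Integrable.of_bound (by fun_prop) 1 (ae_of_all _ fun x => by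
      rw [Complex.norm_exp_ofReal_mul_I])
  have h1 := integral_re hi
  have h2 := integral_im hi
  simp only [RCLike.re_to_complex, RCLike.im_to_complex, Complex.exp_ofReal_mul_I_re,
    Complex.exp_ofReal_mul_I_im] at h1 h2
  rw [charFun_apply]
  exact ⟨h1.symm, h2.symm⟩

/-- The limit covariance is the covariance of the features `cas s`, `cas t` under `μ`. -/
lemma integral_centeredCas_mul (s t : EuclideanSpace ℝ (Fin d)) :
    ∫ x, centeredCas μ s x * centeredCas μ t x ∂μ = limitCov (charFun μ) t s := by
  have hm : ∀ t, ∫ y, cas t y ∂μ = (charFun μ t).re + (charFun μ t).im := by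
    intro t
    rw [(charFun_re_im μ t).1, (charFun_re_im μ t).2,
      ← integral_add (integrable_cos_inner μ t) (integrable_sin_inner μ t)]
    rfl
  have e : ∀ x, centeredCas μ s x * centeredCas μ t x =
      (Real.cos ⟪x, s - t⟫ + Real.sin ⟪x, s + t⟫) - (∫ y, cas s y ∂μ) * cas t x -
        (∫ y, cas t y ∂μ) * cas s x + (∫ y, cas s y ∂μ) * (∫ y, cas t y ∂μ) := by
    intro x
    unfold centeredCas
    have : cas s x * cas t x = Real.cos ⟪x, s - t⟫ + Real.sin ⟪x, s + t⟫ := by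
      unfold cas
      rw [inner_sub_right, inner_add_right, Real.cos_sub, Real.sin_add]
      ring
    rw [← this]; ring
  have i1 : Integrable (fun x => Real.cos ⟪x, s - t⟫ + Real.sin ⟪x, s + t⟫) μ :=
    (integrable_cos_inner μ _).add (integrable_sin_inner μ _)
  have i2 : Integrable (fun x => (∫ y, cas s y ∂μ) * cas t x) μ := (integrable_cas μ t).const_mul _
  have i3 : Integrable (fun x => (∫ y, cas t y ∂μ) * cas s x) μ := (integrable_cas μ s).const_mul _
  have i12 : Integrable (fun x => Real.cos ⟪x, s - t⟫ + Real.sin ⟪x, s + t⟫ -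
      (∫ y, cas s y ∂μ) * cas t x) μ := i1.sub i2
  have i123 : Integrable (fun x => Real.cos ⟪x, s - t⟫ + Real.sin ⟪x, s + t⟫ -
      (∫ y, cas s y ∂μ) * cas t x - (∫ y, cas t y ∂μ) * cas s x) μ := i12.sub i3
  simp only [e]
  rw [integral_add i123 (integrable_const _), integral_sub i12 i3, integral_sub i1 i2,
    integral_add (integrable_cos_inner μ _) (integrable_sin_inner μ _),
    integral_const_mul, integral_const_mul, ← (charFun_re_im μ _).1, ← (charFun_re_im μ _).2,
    hm, hm]
  simp only [integral_const, probReal_univ, smul_eq_mul, limitCov]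
  ring

lemma limitCov_self_nonneg (t : EuclideanSpace ℝ (Fin d)) : 0 ≤ limitCov (charFun μ) t t := by
  rw [← integral_centeredCas_mul]
  exact integral_nonneg fun x => mul_self_nonneg _

lemma limitCov_self_le (t : EuclideanSpace ℝ (Fin d)) : limitCov (charFun μ) t t ≤ 16 := by
  rw [← integral_centeredCas_mul]
  calc _ ≤ ∫ _, (16 : ℝ) ∂μ := by
        refine integral_mono (integrable_centeredCas_mul μ t t) (integrable_const _) fun x => ?_
        have := abs_centeredCas_le μ t x
        rw [abs_le] at this
        show centeredCas μ t x * centeredCas μ t x ≤ 16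
        nlinarith [this.1, this.2]
    _ = 16 := by simp

lemma integral_sum_mul_centeredCas_sq {N : ℕ} (u : Fin N → EuclideanSpace ℝ (Fin d))
    (a : Fin N → ℝ) :
    ∫ x, (∑ j, a j * centeredCas μ (u j) x) ^ 2 ∂μ =
      ∑ j, ∑ l, a j * a l * limitCov (charFun μ) (u l) (u j) := by
  have e : ∀ x, (∑ j, a j * centeredCas μ (u j) x) ^ 2 =
      ∑ j, ∑ l, a j * a l * (centeredCas μ (u j) x * centeredCas μ (u l) x) := by
    intro x
    rw [pow_two, Finset.sum_mul_sum]
    exact Finset.sum_congr rfl fun j _ => Finset.sum_congr rfl fun l _ => by ring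
  simp only [e]
  rw [integral_finsetSum _ fun j _ => integrable_finsetSum _ fun l _ =>
    (integrable_centeredCas_mul μ _ _).const_mul _]
  refine Finset.sum_congr rfl fun j _ => ?_
  rw [integral_finsetSum _ fun l _ => (integrable_centeredCas_mul μ _ _).const_mul _]
  refine Finset.sum_congr rfl fun l _ => ?_
  rw [integral_const_mul, integral_centeredCas_mul]

end Features

/-! ### Properties of the limit process -/

section LimitProcess

variable {d : ℕ} {μ : Measure (EuclideanSpace ℝ (Fin d))}
  {Ω' : Type*} [MeasurableSpace Ω'] {P' : Measure Ω'}
  {Z : EuclideanSpace ℝ (Fin d) → Ω' → ℝ}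

lemma IsLimitProcess.measurable_eval (hZ : IsLimitProcess (charFun μ) Z P')
    (t : EuclideanSpace ℝ (Fin d)) : Measurable (Z t) :=
  hZ.measurable.comp measurable_prodMk_left

lemma IsLimitProcess.integrable_mul (hZ : IsLimitProcess (charFun μ) Z P')
    (s t : EuclideanSpace ℝ (Fin d)) : Integrable (fun ω => Z s ω * Z t ω) P' :=
  (hZ.gaussian.hasGaussianLaw_eval s).memLp_two.integrable_mul
    (hZ.gaussian.hasGaussianLaw_eval t).memLp_two

lemma IsLimitProcess.charFun_map_sum (hZ : IsLimitProcess (charFun μ) Z P') {N : ℕ}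
    (u : Fin N → EuclideanSpace ℝ (Fin d)) (a : Fin N → ℝ) :
    charFun (P'.map fun ω => ∑ j, a j * Z (u j) ω) 1 =
      Complex.exp (-((∑ j, ∑ l, a j * a l * limitCov (charFun μ) (u l) (u j) : ℝ) / 2)) := by
  have hg : HasGaussianLaw (fun ω => ∑ j, a j * Z (u j) ω) P' :=
    ((hZ.gaussian.comp_right u).smul a).hasGaussianLaw_fun_sum (I := Finset.univ)
  have hmean : ∫ ω, ∑ j, a j * Z (u j) ω ∂P' = 0 := by
    rw [integral_finsetSum _ fun j _ =>
      ((hZ.gaussian.hasGaussianLaw_eval (u j)).integrable.const_mul _)]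
    simp [integral_const_mul, hZ.centered]
  have hvar : Var[fun ω => ∑ j, a j * Z (u j) ω; P'] =
      ∑ j, ∑ l, a j * a l * limitCov (charFun μ) (u l) (u j) := by
    rw [variance_eq_integral hg.aemeasurable, hmean]
    have e : ∀ ω, (∑ j, a j * Z (u j) ω - 0) ^ 2 =
        ∑ j, ∑ l, a j * a l * (Z (u j) ω * Z (u l) ω) := by
      intro ω
      rw [sub_zero, pow_two, Finset.sum_mul_sum]
      exact Finset.sum_congr rfl fun j _ => Finset.sum_congr rfl fun l _ => by ring
    simp only [e]
    rw [integral_finsetSum _ fun j _ => integrable_finsetSum _ fun l _ =>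
      (hZ.integrable_mul _ _).const_mul _]
    refine Finset.sum_congr rfl fun j _ => ?_
    rw [integral_finsetSum _ fun l _ => (hZ.integrable_mul _ _).const_mul _]
    refine Finset.sum_congr rfl fun l _ => ?_
    rw [integral_const_mul, hZ.covariance]
  rw [hg.map_eq_gaussianReal, charFun_gaussianReal, hmean, hvar]
  have h0 : 0 ≤ ∑ j, ∑ l, a j * a l * limitCov (charFun μ) (u l) (u j) := by
    rw [← hvar]; exact variance_nonneg _ _
  congr 1
  rw [Real.coe_toNNReal _ h0]
  push_cast
  ring

lemma IsLimitProcess.map_eq_gaussianReal (hZ : IsLimitProcess (charFun μ) Z P')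
    (t : EuclideanSpace ℝ (Fin d)) :
    P'.map (Z t) = gaussianReal 0 (limitCov (charFun μ) t t).toNNReal := by
  rw [(hZ.gaussian.hasGaussianLaw_eval t).map_eq_gaussianReal, hZ.centered,
    variance_eq_integral (hZ.measurable_eval t).aemeasurable, hZ.centered, ← hZ.covariance]
  simp [pow_two]

lemma IsLimitProcess.lintegral_enorm_sq (hZ : IsLimitProcess (charFun μ) Z P')
    (t : EuclideanSpace ℝ (Fin d)) :
    ∫⁻ ω, ‖Z t ω ^ 2‖ₑ ∂P' = ENNReal.ofReal (limitCov (charFun μ) t t) := by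
  rw [← hZ.covariance t t, ofReal_integral_eq_lintegral_ofReal (hZ.integrable_mul t t)
    (ae_of_all _ fun ω => mul_self_nonneg _)]
  refine lintegral_congr fun ω => ?_
  rw [Real.enorm_eq_ofReal (sq_nonneg _), pow_two]

lemma IsLimitProcess.lintegral_pow_four_le [IsProbabilityMeasure μ]
    (hZ : IsLimitProcess (charFun μ) Z P')
    (t : EuclideanSpace ℝ (Fin d)) :
    ∫⁻ ω, ENNReal.ofReal ((Z t ω ^ 2) ^ 2) ∂P' ≤ ENNReal.ofReal (48 * Real.exp (16 / 2)) := by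
  refine (lintegral_pow_four_le_of_hasSubgaussianMGF (hasSubgaussianMGF_of_map_eq_gaussianReal
    (hZ.measurable_eval t).aemeasurable (hZ.map_eq_gaussianReal t))).trans ?_
  rw [Real.coe_toNNReal _ (limitCov_self_nonneg μ t)]
  have := limitCov_self_le μ t
  gcongr

end LimitProcess

/-! ### The weighted empirical process -/

section Empirical

variable {d : ℕ} {μ : Measure (EuclideanSpace ℝ (Fin d))}
  {Ω : Type*} [MeasurableSpace Ω] {P : Measure Ω}
  {ι : Type*} {ξ : ι → Ω → EuclideanSpace ℝ (Fin d)}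

lemma integral_comp_of_map_eq {X : Ω → EuclideanSpace ℝ (Fin d)} (hX : Measurable X)
    (h : P.map X = μ) {f : EuclideanSpace ℝ (Fin d) → ℝ} (hf : Measurable f) :
    ∫ ω, f (X ω) ∂P = ∫ x, f x ∂μ := by
  rw [← h, integral_map hX.aemeasurable hf.aestronglyMeasurable]

lemma sum_cas_eq_sum_centeredCas {s : Finset ι} {c : ι → ℝ} (hc : ∑ i ∈ s, c i = 0)
    (μ : Measure (EuclideanSpace ℝ (Fin d))) (t : EuclideanSpace ℝ (Fin d))
    (x : ι → EuclideanSpace ℝ (Fin d)) :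
    ∑ i ∈ s, c i * cas t (x i) = ∑ i ∈ s, c i * centeredCas μ t (x i) := by
  simp [centeredCas, mul_sub, ← Finset.sum_mul, hc]

/-- The Cramér–Wold reduction of a random vector to its linear combinations. -/
lemma charFun_map_toLp {N : ℕ} {Y : Fin N → Ω → ℝ} (hY : ∀ j, Measurable (Y j))
    (a : EuclideanSpace ℝ (Fin N)) :
    charFun (P.map fun ω => WithLp.toLp 2 fun j => Y j ω) a =
      charFun (P.map fun ω => ∑ j, a j * Y j ω) 1 := by
  have h1 : Measurable fun ω => (WithLp.toLp 2 fun j => Y j ω : EuclideanSpace ℝ (Fin N)) := by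
    fun_prop
  have h2 : Measurable fun ω => ∑ j, a j * Y j ω := by fun_prop
  rw [charFun_apply, charFun_apply, integral_map h1.aemeasurable (by fun_prop),
    integral_map h2.aemeasurable (by fun_prop)]
  simp [PiLp.inner_apply]

variable [IsProbabilityMeasure μ] [IsProbabilityMeasure P]

/-- By Hoeffding's lemma, since the centered features are bounded by `4`. -/
lemma hasSubgaussianMGF_sum_cas (hξ : ∀ i, Measurable (ξ i)) (hlaw : ∀ i, P.map (ξ i) = μ)
    (hind : iIndepFun ξ P) {s : Finset ι} {c : ι → ℝ} (hc : ∑ i ∈ s, c i = 0)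
    (hc2 : ∑ i ∈ s, c i ^ 2 = 1) (t : EuclideanSpace ℝ (Fin d)) :
    HasSubgaussianMGF (fun ω => ∑ i ∈ s, c i * cas t (ξ i ω)) 16 P := by
  simp only [fun ω => sum_cas_eq_sum_centeredCas hc μ t (fun i => ξ i ω)]
  have hm (i : ι) : Measurable fun ω => centeredCas μ t (ξ i ω) :=
    (measurable_centeredCas_right μ t).comp (hξ i)
  have h1 (i : ι) : HasSubgaussianMGF (fun ω => centeredCas μ t (ξ i ω))
      ((‖(4 : ℝ) - (-4)‖₊ / 2) ^ 2) P := by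
    refine hasSubgaussianMGF_of_mem_Icc_of_integral_eq_zero (hm i).aemeasurable
      (ae_of_all _ fun ω => abs_le.1 (abs_centeredCas_le μ t _)) ?_
    rw [integral_comp_of_map_eq (hξ i) (hlaw i) (measurable_centeredCas_right μ t),
      integral_centeredCas]
  have hind' : iIndepFun (fun i ω => c i * centeredCas μ t (ξ i ω)) P :=
    hind.comp (fun i x => c i * centeredCas μ t x)
      fun i => (measurable_centeredCas_right μ t).const_mul _
  have h2 (i : ι) : HasSubgaussianMGF (fun ω => c i * centeredCas μ t (ξ i ω))
      (‖c i‖₊ ^ 2 * 16) P := by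
    refine ⟨fun r => ?_, fun r => ?_⟩
    · simpa only [mul_assoc] using (h1 i).integrable_exp_mul (r * c i)
    · rw [mgf_const_mul]
      refine ((h1 i).mgf_le _).trans (le_of_eq ?_)
      congr 1
      norm_num
      ring
  have h3 := HasSubgaussianMGF.sum_of_iIndepFun hind' (s := s) fun i _ => h2 i
  rwa [← Finset.sum_mul, show ∑ i ∈ s, ‖c i‖₊ ^ 2 = 1 by
    apply NNReal.eq; simpa using hc2, one_mul] at h3

lemma lintegral_enorm_sum_cas_sq (hξ : ∀ i, Measurable (ξ i)) (hlaw : ∀ i, P.map (ξ i) = μ)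
    (hind : iIndepFun ξ P) {s : Finset ι} {c : ι → ℝ} (hc : ∑ i ∈ s, c i = 0)
    (hc2 : ∑ i ∈ s, c i ^ 2 = 1) (t : EuclideanSpace ℝ (Fin d)) :
    ∫⁻ ω, ‖(∑ i ∈ s, c i * cas t (ξ i ω)) ^ 2‖ₑ ∂P =
      ENNReal.ofReal (limitCov (charFun μ) t t) := by
  simp only [fun ω => sum_cas_eq_sum_centeredCas hc μ t (fun i => ξ i ω)]
  have hm (i : ι) : Measurable fun ω => centeredCas μ t (ξ i ω) :=
    (measurable_centeredCas_right μ t).comp (hξ i)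
  have hl (i : ι) : MemLp (fun ω => c i * centeredCas μ t (ξ i ω)) 2 P :=
    (MemLp.of_bound (hm i).aestronglyMeasurable 4
      (ae_of_all _ fun ω => abs_centeredCas_le μ t _)).const_mul _
  have hmean (i : ι) : ∫ ω, centeredCas μ t (ξ i ω) ∂P = 0 := by
    rw [integral_comp_of_map_eq (hξ i) (hlaw i) (measurable_centeredCas_right μ t),
      integral_centeredCas]
  have hsq (i : ι) : ∫ ω, centeredCas μ t (ξ i ω) ^ 2 ∂P = limitCov (charFun μ) t t := by
    rw [← integral_centeredCas_mul μ t, integral_comp_of_map_eq (hξ i) (hlaw i)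
      ((measurable_centeredCas_right μ t).pow_const 2)]
    simp only [pow_two]
  have hvar := IndepFun.variance_sum (s := s) (μ := P)
    (X := fun i ω => c i * centeredCas μ t (ξ i ω)) (fun i _ => hl i)
    (fun i _ j _ hij => (hind.indepFun hij).comp
      ((measurable_centeredCas_right μ t).const_mul (c i))
      ((measurable_centeredCas_right μ t).const_mul (c j)))
  have hv (i : ι) : Var[fun ω => c i * centeredCas μ t (ξ i ω); P] =
      c i ^ 2 * limitCov (charFun μ) t t := by
    rw [variance_const_mul, variance_eq_integral (hm i).aemeasurable, hmean]
    simp [hsq]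
  simp only [hv, ← Finset.sum_mul, hc2, one_mul] at hvar
  have hsum : MemLp (fun ω => ∑ i ∈ s, c i * centeredCas μ t (ξ i ω)) 2 P :=
    memLp_finsetSum _ fun i _ => hl i
  rw [show (∑ i ∈ s, fun ω => c i * centeredCas μ t (ξ i ω)) =
    fun ω => ∑ i ∈ s, c i * centeredCas μ t (ξ i ω) by ext; simp,
    variance_eq_integral hsum.1.aemeasurable,
    integral_finsetSum _ fun i _ => (hl i).integrable (by norm_num)] at hvar
  simp only [integral_const_mul, hmean, mul_zero, Finset.sum_const_zero, sub_zero] at hvar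
  rw [← hvar, ofReal_integral_eq_lintegral_ofReal hsum.integrable_sq
    (ae_of_all _ fun ω => sq_nonneg _)]
  exact lintegral_congr fun ω => Real.enorm_eq_ofReal (sq_nonneg _)

/-- Finite-dimensional convergence of the weighted empirical process to the limit process. -/
theorem IsNegligibleContrast.tendsto_integral_sum_cas {s : ℕ → Finset ι} {c : ℕ → ι → ℝ}
    (hc : IsNegligibleContrast s c)
    (hξ : ∀ i, Measurable (ξ i)) (hlaw : ∀ i, P.map (ξ i) = μ) (hind : iIndepFun ξ P)
    {Ω' : Type*} [MeasurableSpace Ω'] {P' : Measure Ω'} [IsProbabilityMeasure P']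
    {Z : EuclideanSpace ℝ (Fin d) → Ω' → ℝ} (hZ : IsLimitProcess (charFun μ) Z P')
    {N : ℕ} (u : Fin N → EuclideanSpace ℝ (Fin d)) {f : (Fin N → ℝ) → ℝ} (hf : Continuous f)
    {B : ℝ} (hB : ∀ x, |f x| ≤ B) :
    Tendsto (fun k => ∫ ω, f (fun j => ∑ i ∈ s k, c k i * cas (u j) (ξ i ω)) ∂P) atTop
      (𝓝 (∫ ω, f (fun j => Z (u j) ω) ∂P')) := by
  have hcas (k : ℕ) (j : Fin N) : Measurable fun ω => ∑ i ∈ s k, c k i * cas (u j) (ξ i ω) :=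
    Finset.measurable_sum _ fun i _ => ((measurable_cas_right (u j)).comp (hξ i)).const_mul _
  have hVm (k : ℕ) : Measurable fun ω =>
      (WithLp.toLp 2 fun j => ∑ i ∈ s k, c k i * cas (u j) (ξ i ω) : EuclideanSpace ℝ (Fin N)) := by
    have := hcas k
    fun_prop
  have hZm : Measurable fun ω =>
      (WithLp.toLp 2 fun j => Z (u j) ω : EuclideanSpace ℝ (Fin N)) := by
    have := hZ.measurable_eval
    fun_prop
  let ρ : ℕ → ProbabilityMeasure (EuclideanSpace ℝ (Fin N)) := fun k =>
    ⟨P.map fun ω => WithLp.toLp 2 fun j => ∑ i ∈ s k, c k i * cas (u j) (ξ i ω),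
      Measure.isProbabilityMeasure_map (hVm k).aemeasurable⟩
  let ρ' : ProbabilityMeasure (EuclideanSpace ℝ (Fin N)) :=
    ⟨P'.map fun ω => WithLp.toLp 2 fun j => Z (u j) ω,
      Measure.isProbabilityMeasure_map hZm.aemeasurable⟩
  have key : Tendsto ρ atTop (𝓝 ρ') := by
    refine ProbabilityMeasure.tendsto_of_tendsto_charFun fun a => ?_
    show Tendsto (fun k => charFun (P.map fun ω =>
      WithLp.toLp 2 fun j => ∑ i ∈ s k, c k i * cas (u j) (ξ i ω)) a) atTop
      (𝓝 (charFun (P'.map fun ω => WithLp.toLp 2 fun j => Z (u j) ω) a))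
    rw [charFun_map_toLp (fun j => hZ.measurable_eval (u j)), hZ.charFun_map_sum,
      ← integral_sum_mul_centeredCas_sq]
    set φ : EuclideanSpace ℝ (Fin d) → ℝ := fun x => ∑ j, a j * centeredCas μ (u j) x with hφ
    have hφm : Measurable φ := Finset.measurable_sum _ fun j _ =>
      (measurable_centeredCas_right μ (u j)).const_mul _
    have : IsProbabilityMeasure (μ.map φ) := Measure.isProbabilityMeasure_map hφm.aemeasurable
    have hφ2 : MemLp φ 2 μ := memLp_finsetSum _ fun j _ =>
      (MemLp.of_bound (measurable_centeredCas_right μ (u j)).aestronglyMeasurable 4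
        (ae_of_all _ fun x => abs_centeredCas_le μ (u j) x)).const_mul _
    have h2 : MemLp id 2 (μ.map φ) := by
      rw [memLp_map_measure_iff (by fun_prop) hφm.aemeasurable]
      exact hφ2
    have h0 : ∫ x, x ∂(μ.map φ) = 0 := by
      rw [integral_map hφm.aemeasurable (by fun_prop), hφ,
        integral_finsetSum _ fun j _ => (integrable_centeredCas μ (u j)).const_mul _]
      simp [integral_const_mul, integral_centeredCas]
    have hsq : ∫ x, x ^ 2 ∂(μ.map φ) = ∫ x, φ x ^ 2 ∂μ := by
      rw [integral_map hφm.aemeasurable (by fun_prop)]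
    have hlim := hc.tendsto_prod_charFun h2 h0
    rw [hsq] at hlim
    refine hlim.congr fun k => ?_
    rw [charFun_map_toLp (hcas k)]
    have e : (fun ω => ∑ j, a j * ∑ i ∈ s k, c k i * cas (u j) (ξ i ω)) =
        fun ω => ∑ i ∈ s k, c k i * φ (ξ i ω) := by
      ext ω
      simp only [sum_cas_eq_sum_centeredCas (hc.sum_eq_zero k) μ _ (fun i => ξ i ω), hφ,
        Finset.mul_sum]
      rw [Finset.sum_comm]
      exact Finset.sum_congr rfl fun j _ => Finset.sum_congr rfl fun l _ => by ring
    have hind' : iIndepFun (fun i ω => c k i * φ (ξ i ω)) P :=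
      hind.comp (fun i x => c k i * φ x) fun i => hφm.const_mul _
    rw [e, iIndepFun.charFun_map_fun_finsetSum_eq_prod
      (X := fun i ω => c k i * φ (ξ i ω))
      (fun i _ => ((hφm.comp (hξ i)).const_mul _).aemeasurable) (hind'.restrict _)]
    rw [Finset.prod_apply]
    refine Finset.prod_congr rfl fun i _ => ?_
    have hcomp := charFun_map_mul_comp (hφm.comp (hξ i)).aemeasurable (μ := P) (c k i) 1
    rw [← Measure.map_map hφm (hξ i), hlaw i, mul_one] at hcomp
    exact hcomp.symm
  rw [ProbabilityMeasure.tendsto_iff_forall_integral_tendsto] at key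
  have h := key (BoundedContinuousFunction.ofNormedAddCommGroup (fun x => f (WithLp.ofLp x))
    (by fun_prop) B fun x => hB _)
  simp only [BoundedContinuousFunction.coe_ofNormedAddCommGroup, ρ, ρ',
    ProbabilityMeasure.coe_mk] at h
  rw [integral_map hZm.aemeasurable (by fun_prop)] at h
  refine h.congr fun k => ?_
  rw [integral_map (hVm k).aemeasurable (by fun_prop)]

end Empirical

/-! ### Existence of the limit process -/

section Existence

/-- The law of a sequence of independent standard normal random variables. -/
noncomputable def gaussianSequence : Measure (ℕ → ℝ) :=
  Measure.infinitePi fun _ => gaussianReal 0 1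

instance : IsProbabilityMeasure gaussianSequence := by
  unfold gaussianSequence; infer_instance

lemma map_eval_gaussianSequence (n : ℕ) :
    gaussianSequence.map (fun ω => ω n) = gaussianReal 0 1 :=
  Measure.infinitePi_map_eval _ n

lemma integral_of_map_eq_gaussianReal {Ω : Type*} [MeasurableSpace Ω] {P : Measure Ω}
    {X : Ω → ℝ} {v : ℝ≥0} (hX : Measurable X) (h : P.map X = gaussianReal 0 v) :
    ∫ ω, X ω ∂P = 0 ∧ ∫ ω, X ω ^ 2 ∂P = v := by
  have h1 := integral_map (μ := P) hX.aemeasurable (f := fun x => x) (by fun_prop)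
  have h2 := integral_map (μ := P) hX.aemeasurable (f := fun x => x ^ 2) (by fun_prop)
  have hv := variance_fun_id_gaussianReal (μ := 0) (v := v)
  rw [variance_eq_integral aemeasurable_id'] at hv
  simp only [integral_id_gaussianReal, sub_zero] at hv
  rw [h, integral_id_gaussianReal] at h1
  rw [h, hv] at h2
  exact ⟨h1.symm, h2.symm⟩

lemma iIndepFun_mul_gaussianSequence (c : ℕ → ℝ) :
    iIndepFun (fun n (ω : ℕ → ℝ) => c n * ω n) gaussianSequence :=
  iIndepFun_infinitePi (P := fun _ => gaussianReal 0 1) (X := fun n x => c n * x)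
    fun n => measurable_const_mul (c n)

lemma map_mul_gaussianSequence (c : ℝ) (n : ℕ) :
    gaussianSequence.map (fun ω => c * ω n) = gaussianReal 0 (Real.toNNReal (c ^ 2)) := by
  have h := gaussianReal_map_const_mul (μ := 0) (v := 1) c
  rw [← map_eval_gaussianSequence n, Measure.map_map (by fun_prop) (by fun_prop)] at h
  refine h.trans ?_
  congr 1
  · simp
  · rw [mul_one]
    exact NNReal.eq (by rw [Real.coe_toNNReal _ (sq_nonneg c)]; rfl)

lemma map_sum_gaussianSequence (c : ℕ → ℝ) (N : ℕ) :
    gaussianSequence.map (fun ω => ∑ n ∈ Finset.range N, c n * ω n) =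
      gaussianReal 0 (Real.toNNReal (∑ n ∈ Finset.range N, c n ^ 2)) := by
  have hm : Measurable fun ω : ℕ → ℝ => ∑ n ∈ Finset.range N, c n * ω n := by fun_prop
  have := Measure.isProbabilityMeasure_map (μ := gaussianSequence) hm.aemeasurable
  refine Measure.ext_of_charFun (funext fun θ => ?_)
  rw [iIndepFun.charFun_map_fun_finsetSum_eq_prod
    (X := fun n (ω : ℕ → ℝ) => c n * ω n)
    (fun n _ => ((measurable_const_mul (c n)).comp (measurable_pi_apply n)).aemeasurable)
    ((iIndepFun_mul_gaussianSequence c).restrict _), Finset.prod_apply]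
  simp only [map_mul_gaussianSequence, charFun_gaussianReal]
  rw [← Complex.exp_sum]
  congr 1
  rw [Real.coe_toNNReal _ (Finset.sum_nonneg fun n _ => sq_nonneg _)]
  simp only [Real.coe_toNNReal _ (sq_nonneg _)]
  push_cast
  rw [Finset.sum_mul, Finset.sum_div]
  simp

lemma integrable_sum_gaussianSequence (c : ℕ → ℝ) (N : ℕ) :
    Integrable (fun ω : ℕ → ℝ => (∑ n ∈ Finset.range N, c n * ω n) ^ 2) gaussianSequence ∧
      ∫ ω, (∑ n ∈ Finset.range N, c n * ω n) ^ 2 ∂gaussianSequence =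
        ∑ n ∈ Finset.range N, c n ^ 2 := by
  have hm : Measurable fun ω : ℕ → ℝ => ∑ n ∈ Finset.range N, c n * ω n := by fun_prop
  have hg : HasGaussianLaw (fun ω : ℕ → ℝ => ∑ n ∈ Finset.range N, c n * ω n) gaussianSequence :=
    ⟨by rw [map_sum_gaussianSequence]; infer_instance⟩
  refine ⟨hg.memLp_two.integrable_sq, ?_⟩
  rw [(integral_of_map_eq_gaussianReal hm (map_sum_gaussianSequence c N)).2,
    Real.coe_toNNReal _ (Finset.sum_nonneg fun n _ => sq_nonneg _)]

/-- Square-summable Gaussian series converge almost surely, as `L²`-bounded martingales. -/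
lemma ae_exists_tendsto_sum_gaussianSequence {c : ℕ → ℝ} (hc : Summable fun n => c n ^ 2) :
    ∀ᵐ ω ∂gaussianSequence, ∃ l,
      Tendsto (fun N => ∑ n ∈ Finset.range N, c n * ω n) atTop (𝓝 l) := by
  have hsm : ∀ n, StronglyMeasurable fun ω : ℕ → ℝ => c n * ω n := fun n =>
    Measurable.stronglyMeasurable (by fun_prop)
  let ℱ := Filtration.natural (fun n (ω : ℕ → ℝ) => c n * ω n) hsm
  have hint (n : ℕ) : Integrable (fun ω : ℕ → ℝ => c n * ω n) gaussianSequence := by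
    have : HasGaussianLaw (fun ω : ℕ → ℝ => c n * ω n) gaussianSequence :=
      ⟨by rw [map_mul_gaussianSequence]; infer_instance⟩
    exact this.integrable
  have hmean (n : ℕ) : ∫ ω : ℕ → ℝ, c n * ω n ∂gaussianSequence = 0 := by
    exact (integral_of_map_eq_gaussianReal (by fun_prop) (map_mul_gaussianSequence (c n) n)).1
  have hmart : Martingale (fun N (ω : ℕ → ℝ) => ∑ n ∈ Finset.range (N + 1), c n * ω n) ℱ
      gaussianSequence := by
    refine martingale_of_condExp_sub_eq_zero_nat (fun N => ?_)
      (fun N => integrable_finsetSum _ fun n _ => hint n) fun N => ?_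
    · refine Finset.stronglyMeasurable_fun_sum _ fun n hn => ?_
      exact ((Filtration.stronglyAdapted_natural hsm) n).mono
        (ℱ.mono (Nat.lt_succ_iff.1 (Finset.mem_range.1 hn)))
    · have e : ((fun ω : ℕ → ℝ => ∑ n ∈ Finset.range (N + 1 + 1), c n * ω n) -
          fun ω => ∑ n ∈ Finset.range (N + 1), c n * ω n) = fun ω => c (N + 1) * ω (N + 1) := by
        ext ω
        simp [Finset.sum_range_succ]
      rw [e]
      have h := iIndepFun.condExp_natural_ae_eq_of_lt hsm (iIndepFun_mul_gaussianSequence c)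
        (Nat.lt_succ_self N)
      simp only [Nat.succ_eq_add_one, hmean] at h
      exact h
  have hbdd (N : ℕ) : eLpNorm (fun ω : ℕ → ℝ => ∑ n ∈ Finset.range (N + 1), c n * ω n) 1
      gaussianSequence ≤ (Real.toNNReal (1 + ∑' n, c n ^ 2) : ℝ≥0) := by
    obtain ⟨h1, h2⟩ := integrable_sum_gaussianSequence c (N + 1)
    rw [eLpNorm_one_eq_lintegral_enorm]
    calc ∫⁻ ω : ℕ → ℝ, ‖∑ n ∈ Finset.range (N + 1), c n * ω n‖ₑ ∂gaussianSequence
        ≤ ∫⁻ ω : ℕ → ℝ, ENNReal.ofReal (1 + (∑ n ∈ Finset.range (N + 1), c n * ω n) ^ 2)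
            ∂gaussianSequence := by
          refine lintegral_mono fun ω => ?_
          rw [← ofReal_norm, Real.norm_eq_abs]
          refine ENNReal.ofReal_le_ofReal ?_
          rw [← sq_abs]
          nlinarith [sq_nonneg (|∑ n ∈ Finset.range (N + 1), c n * ω n| - 1),
            abs_nonneg (∑ n ∈ Finset.range (N + 1), c n * ω n)]
      _ = ENNReal.ofReal (1 + ∑ n ∈ Finset.range (N + 1), c n ^ 2) := by
          have h3 : Integrable (fun ω : ℕ → ℝ =>
              1 + (∑ n ∈ Finset.range (N + 1), c n * ω n) ^ 2) gaussianSequence :=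
            (integrable_const _).add h1
          rw [← ofReal_integral_eq_lintegral_ofReal h3
            (ae_of_all _ fun ω => by positivity), integral_add (integrable_const _) h1, h2]
          simp
      _ ≤ _ := ENNReal.ofReal_le_ofReal
          (by gcongr; exact hc.sum_le_tsum _ fun n _ => sq_nonneg _)
  filter_upwards [hmart.submartingale.exists_ae_tendsto_of_bdd hbdd] with ω ⟨l, hl⟩
  exact ⟨l, (tendsto_add_atTop_iff_nat 1).1 hl⟩

lemma map_eq_gaussianReal_of_tendsto {c : ℕ → ℝ} {v : ℝ} (hc : HasSum (fun n => c n ^ 2) v)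
    {W : (ℕ → ℝ) → ℝ} (hW : Measurable W)
    (hlim : ∀ᵐ ω ∂gaussianSequence,
      Tendsto (fun N => ∑ n ∈ Finset.range N, c n * ω n) atTop (𝓝 (W ω))) :
    gaussianSequence.map W = gaussianReal 0 v.toNNReal := by
  have := Measure.isProbabilityMeasure_map (μ := gaussianSequence) hW.aemeasurable
  have hv : 0 ≤ v := hc.nonneg fun n => sq_nonneg _
  refine Measure.ext_of_charFun (funext fun θ => ?_)
  have h1 : Tendsto (fun N => charFun (gaussianSequence.map
      (fun ω => ∑ n ∈ Finset.range N, c n * ω n)) θ) atTop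
      (𝓝 (charFun (gaussianSequence.map W) θ)) := by
    simp only [charFun_apply]
    rw [integral_map hW.aemeasurable (by fun_prop)]
    have hm (N : ℕ) : Measurable fun ω : ℕ → ℝ => ∑ n ∈ Finset.range N, c n * ω n := by fun_prop
    have e (N : ℕ) := integral_map (μ := gaussianSequence) (hm N).aemeasurable
      (f := fun x : ℝ => Complex.exp (⟪x, θ⟫ * Complex.I)) (by fun_prop)
    simp only [e]
    have hcont : Continuous fun x : ℝ => Complex.exp (⟪x, θ⟫ * Complex.I) := by fun_prop
    refine tendsto_integral_of_dominated_convergence (fun _ => 1)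
      (fun N => (hcont.measurable.comp (hm N)).aestronglyMeasurable)
      (integrable_const _) (fun N => ae_of_all _ fun ω => by rw [Complex.norm_exp_ofReal_mul_I]) ?_
    filter_upwards [hlim] with ω hω
    exact (hcont.tendsto _).comp hω
  have h2 : Tendsto (fun N => charFun (gaussianSequence.map
      (fun ω => ∑ n ∈ Finset.range N, c n * ω n)) θ) atTop
      (𝓝 (charFun (gaussianReal 0 v.toNNReal) θ)) := by
    simp only [map_sum_gaussianSequence, charFun_gaussianReal, Real.coe_toNNReal _ hv]
    simp only [Real.coe_toNNReal _ (Finset.sum_nonneg fun n _ => sq_nonneg (c n))]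
    have hcont : Continuous fun x : ℝ =>
        Complex.exp (θ * ((0 : ℝ) : ℂ) * Complex.I - x * θ ^ 2 / 2) := by fun_prop
    exact (hcont.tendsto _).comp hc.tendsto_sum_nat
  exact tendsto_nhds_unique h1 h2

variable {T : Type*}

/-- The process with coordinate functions `a n` relative to a standard normal sequence, defined as
an upper limit in order to be jointly measurable. -/
noncomputable def gaussianSeries (a : ℕ → T → ℝ) (t : T) (ω : ℕ → ℝ) : ℝ :=
  limsup (fun N => ∑ n ∈ Finset.range N, a n t * ω n) atTop

variable {a : ℕ → T → ℝ} {C : T → T → ℝ}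

lemma measurable_gaussianSeries [MeasurableSpace T] (ha : ∀ n, Measurable (a n)) :
    Measurable fun p : T × (ℕ → ℝ) => gaussianSeries a p.1 p.2 := by
  unfold gaussianSeries
  refine Measurable.limsup fun N => ?_
  exact Finset.measurable_sum _ fun n _ =>
    ((ha n).comp measurable_fst).mul ((measurable_pi_apply n).comp measurable_snd)

lemma ae_tendsto_gaussianSeries (hC : ∀ t s, HasSum (fun n => a n t * a n s) (C t s)) (t : T) :
    ∀ᵐ ω ∂gaussianSequence,
      Tendsto (fun N => ∑ n ∈ Finset.range N, a n t * ω n) atTop (𝓝 (gaussianSeries a t ω)) := by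
  have hs : Summable fun n => a n t ^ 2 := by simpa only [pow_two] using (hC t t).summable
  filter_upwards [ae_exists_tendsto_sum_gaussianSequence hs] with ω ⟨l, hl⟩
  unfold gaussianSeries
  rwa [hl.limsup_eq]

-- only the almost sure limit matters below; unfolding the upper limit would slow down unification
attribute [irreducible] gaussianSeries

variable [MeasurableSpace T]

lemma measurable_gaussianSeries_eval (ha : ∀ n, Measurable (a n)) (t : T) :
    Measurable (gaussianSeries a t) := by
  have h := (measurable_gaussianSeries ha).comp (measurable_prodMk_left (x := t))
  exact h

lemma map_sum_gaussianSeries (ha : ∀ n, Measurable (a n))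
    (hC : ∀ t s, HasSum (fun n => a n t * a n s) (C t s)) {ι : Type*} (I : Finset ι) (u : ι → T)
    (l : ι → ℝ) :
    gaussianSequence.map (fun ω => ∑ i ∈ I, l i * gaussianSeries a (u i) ω) =
      gaussianReal 0 (Real.toNNReal (∑ i ∈ I, ∑ j ∈ I, l i * l j * C (u i) (u j))) := by
  refine map_eq_gaussianReal_of_tendsto (c := fun n => ∑ i ∈ I, l i * a n (u i)) ?_ ?_ ?_
  · have e : ∀ n, (∑ i ∈ I, l i * a n (u i)) ^ 2 =
        ∑ i ∈ I, ∑ j ∈ I, l i * l j * (a n (u i) * a n (u j)) := by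
      intro n
      rw [pow_two, Finset.sum_mul_sum]
      exact Finset.sum_congr rfl fun j _ => Finset.sum_congr rfl fun l _ => by ring
    simp only [e]
    exact hasSum_sum fun i _ => hasSum_sum fun j _ => (hC _ _).mul_left _
  · exact Finset.measurable_sum _ fun i _ =>
      (measurable_gaussianSeries_eval ha (u i)).const_mul _
  · have : ∀ᵐ ω ∂gaussianSequence, ∀ i ∈ I,
        Tendsto (fun N => ∑ n ∈ Finset.range N, a n (u i) * ω n) atTop
          (𝓝 (gaussianSeries a (u i) ω)) :=
      (Finset.eventually_all I).2 fun i _ => ae_tendsto_gaussianSeries hC (u i)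
    filter_upwards [this] with ω hω
    have h := tendsto_finsetSum I fun i hi => (hω i hi).const_mul (l i)
    refine h.congr fun N => ?_
    simp only [Finset.mul_sum, Finset.sum_mul]
    rw [Finset.sum_comm]
    exact Finset.sum_congr rfl fun j _ => Finset.sum_congr rfl fun l _ => by ring

lemma isGaussianProcess_gaussianSeries (ha : ∀ n, Measurable (a n))
    (hC : ∀ t s, HasSum (fun n => a n t * a n s) (C t s)) :
    IsGaussianProcess (gaussianSeries a) gaussianSequence where
  hasGaussianLaw I := by
    have hm : Measurable fun ω : ℕ → ℝ => I.restrict (gaussianSeries a · ω) :=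
      measurable_pi_lambda _ fun i => measurable_gaussianSeries_eval ha i
    refine ⟨isGaussian_of_map_eq_gaussianReal fun L => ?_⟩
    classical
    rw [Measure.map_map (by fun_prop) hm]
    have e : L ∘ (fun ω : ℕ → ℝ => I.restrict (gaussianSeries a · ω)) =
        fun ω => ∑ i : I, L (fun j => if i = j then 1 else 0) * gaussianSeries a (i : T) ω := by
      ext ω
      refine (LinearMap.pi_apply_eq_sum_univ (L : (I → ℝ) →ₗ[ℝ] ℝ) _).trans ?_
      exact Finset.sum_congr rfl fun i _ => mul_comm _ _
    rw [e]
    exact ⟨0, _, map_sum_gaussianSeries ha hC Finset.univ (fun i : I => (i : T)) _⟩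

lemma integral_gaussianSeries (ha : ∀ n, Measurable (a n))
    (hC : ∀ t s, HasSum (fun n => a n t * a n s) (C t s)) (t : T) :
    ∫ ω, gaussianSeries a t ω ∂gaussianSequence = 0 := by
  have h := map_sum_gaussianSeries ha hC {()} (fun _ => t) (fun _ => 1)
  simp only [Finset.sum_singleton, one_mul] at h
  exact (integral_of_map_eq_gaussianReal (measurable_gaussianSeries_eval ha t) h).1

lemma integral_gaussianSeries_mul (ha : ∀ n, Measurable (a n))
    (hC : ∀ t s, HasSum (fun n => a n t * a n s) (C t s)) (t s : T) :
    ∫ ω, gaussianSeries a t ω * gaussianSeries a s ω ∂gaussianSequence = C t s := by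
  have hm := measurable_gaussianSeries_eval ha
  have hl (t : T) : MemLp (gaussianSeries a t) 2 gaussianSequence :=
    ((isGaussianProcess_gaussianSeries ha hC).hasGaussianLaw_eval t).memLp_two
  -- second moments of linear combinations determine mixed moments by polarization
  have hsq (l : Fin 2 → ℝ) : ∫ ω, (l 0 * gaussianSeries a t ω + l 1 * gaussianSeries a s ω) ^ 2
      ∂gaussianSequence = l 0 ^ 2 * C t t + 2 * (l 0 * l 1) * C t s + l 1 ^ 2 * C s s := by
    have h := map_sum_gaussianSeries ha hC Finset.univ ![t, s] l
    have hsymm : C s t = C t s := (hC s t).unique (by simpa only [mul_comm] using hC t s)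
    simp only [Fin.sum_univ_two, Matrix.cons_val_zero, Matrix.cons_val_one, hsymm] at h
    have hm2 : Measurable fun ω => l 0 * gaussianSeries a t ω + l 1 * gaussianSeries a s ω :=
      ((hm t).const_mul _).add ((hm s).const_mul _)
    have hnn : 0 ≤ l 0 * l 0 * C t t + l 0 * l 1 * C t s +
        (l 1 * l 0 * C t s + l 1 * l 1 * C s s) := by
      have h3 := (((hC t t).mul_left (l 0 * l 0)).add ((hC t s).mul_left (l 0 * l 1))).add
        (((hC t s).mul_left (l 1 * l 0)).add ((hC s s).mul_left (l 1 * l 1)))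
      refine h3.nonneg fun n => ?_
      nlinarith [sq_nonneg (l 0 * a n t + l 1 * a n s)]
    rw [(integral_of_map_eq_gaussianReal hm2 h).2, Real.coe_toNNReal _ hnn]
    ring
  have h11 := hsq ![1, 1]
  have h10 := hsq ![1, 0]
  have h01 := hsq ![0, 1]
  simp only [Matrix.cons_val_zero, Matrix.cons_val_one] at h11 h10 h01
  have i1 := (hl t).integrable_sq
  have i2 := (hl s).integrable_sq
  have i3 := (hl t).integrable_mul (hl s)
  have e : ∀ ω, (1 * gaussianSeries a t ω + 1 * gaussianSeries a s ω) ^ 2 =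
      gaussianSeries a t ω ^ 2 + (gaussianSeries a s ω ^ 2 +
        2 * (gaussianSeries a t * gaussianSeries a s) ω) := by
    intro ω; simp only [Pi.mul_apply]; ring
  have i23 : Integrable (fun ω => gaussianSeries a s ω ^ 2 +
      2 * (gaussianSeries a t * gaussianSeries a s) ω) gaussianSequence := i2.add (i3.const_mul 2)
  simp only [e] at h11
  rw [integral_add i1 i23, integral_add i2 (i3.const_mul 2),
    integral_const_mul] at h11
  simp only [one_mul, zero_mul, add_zero, zero_add] at h10 h01
  simp only [Pi.mul_apply] at h11
  linarith

lemma countable_of_orthonormal {H : Type*} [NormedAddCommGroup H] [InnerProductSpace ℝ H]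
    [TopologicalSpace.SeparableSpace H] {ι : Type*} {v : ι → H} (hv : Orthonormal ℝ v) :
    Countable ι := by
  refine Pairwise.countable_of_isOpen_disjoint (s := fun i => Metric.ball (v i) (1 / 2))
    (fun i j hij => ?_) (fun i => Metric.isOpen_ball) fun i => Metric.nonempty_ball.2 (by norm_num)
  refine Metric.ball_disjoint_ball ?_
  have h : dist (v i) (v j) ^ 2 = 2 := by
    rw [dist_eq_norm, norm_sub_sq_real, hv.1, hv.1, hv.2 hij]; norm_num
  nlinarith [dist_nonneg (x := v i) (y := v j)]

/-- Coordinates of the centered features in an orthonormal basis of `L²(μ)`. -/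
lemma exists_hasSum_limitCov {d : ℕ} (μ : Measure (EuclideanSpace ℝ (Fin d)))
    [IsProbabilityMeasure μ] :
    ∃ a : ℕ → EuclideanSpace ℝ (Fin d) → ℝ, (∀ n, Measurable (a n)) ∧
      ∀ t s, HasSum (fun n => a n t * a n s) (limitCov (charFun μ) t s) := by
  have hmem (t : EuclideanSpace ℝ (Fin d)) : MemLp (centeredCas μ t) 2 μ :=
    MemLp.of_bound (measurable_centeredCas_right μ t).aestronglyMeasurable 4
      (ae_of_all _ fun x => abs_centeredCas_le μ t x)
  obtain ⟨w, b, -⟩ := exists_hilbertBasis ℝ (Lp ℝ 2 μ)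
  have : Fact ((2 : ℝ≥0∞) ≠ ∞) := ⟨by norm_num⟩
  have : Countable w := countable_of_orthonormal b.orthonormal
  obtain ⟨g, hg⟩ := exists_injective_nat w
  let G : EuclideanSpace ℝ (Fin d) → Lp ℝ 2 μ := fun t => (hmem t).toLp
  have hinner (f : Lp ℝ 2 μ) (t : EuclideanSpace ℝ (Fin d)) :
      ⟪f, G t⟫ = ∫ x, centeredCas μ t x * f x ∂μ := by
    rw [L2.inner_def]
    refine integral_congr_ae ?_
    filter_upwards [(hmem t).coeFn_toLp] with x hx
    simp only [G, hx]
    rfl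
  refine ⟨fun n t => Function.extend g (fun i => ⟪b i, G t⟫) 0 n, fun n => ?_, fun t s => ?_⟩
  · by_cases hn : ∃ i, g i = n
    · obtain ⟨i, rfl⟩ := hn
      simp only [hg.extend_apply, hinner]
      refine (StronglyMeasurable.integral_prod_right' (f := fun p : EuclideanSpace ℝ (Fin d) ×
        EuclideanSpace ℝ (Fin d) => centeredCas μ p.1 p.2 * (b i : Lp ℝ 2 μ) p.2) ?_).measurable
      exact (measurable_centeredCas μ).stronglyMeasurable.mul
        ((Lp.stronglyMeasurable (b i : Lp ℝ 2 μ)).comp_measurable measurable_snd)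
    · simp only [Function.extend_apply' _ _ _ hn]
      exact measurable_const
  · have h := b.hasSum_inner_mul_inner (G s) (G t)
    rw [hinner] at h
    have hv : ∫ x, centeredCas μ t x * G s x ∂μ = limitCov (charFun μ) t s := by
      rw [← integral_centeredCas_mul]
      refine integral_congr_ae ?_
      filter_upwards [(hmem s).coeFn_toLp] with x hx
      simp only [G, hx]
      ring
    rw [hv, ← hasSum_extend_zero hg] at h
    refine h.congr_fun fun n => ?_
    by_cases hn : ∃ i, g i = n
    · obtain ⟨i, rfl⟩ := hn
      simp only [hg.extend_apply]
      rw [real_inner_comm (G s), mul_comm]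
    · simp [Function.extend_apply' _ _ _ hn]

/-- A measurable centered Gaussian process with the limit covariance exists. -/
theorem exists_isLimitProcess {d : ℕ} (μ : Measure (EuclideanSpace ℝ (Fin d)))
    [IsProbabilityMeasure μ] :
    ∃ (Ω₀ : Type) (_ : MeasurableSpace Ω₀) (P₀ : Measure Ω₀) (_ : IsProbabilityMeasure P₀)
      (Z : EuclideanSpace ℝ (Fin d) → Ω₀ → ℝ), IsLimitProcess (charFun μ) Z P₀ := by
  obtain ⟨a, ha, hC⟩ := exists_hasSum_limitCov μ
  refine ⟨ℕ → ℝ, inferInstance, gaussianSequence, inferInstance, gaussianSeries a,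
    measurable_gaussianSeries ha, isGaussianProcess_gaussianSeries ha hC,
    integral_gaussianSeries ha hC, fun t s => ?_⟩
  simp only [mul_comm (gaussianSeries a s _)]
  exact integral_gaussianSeries_mul ha hC t s

end Existence

/-! ### Convergence of the weighted energy statistic -/

section Energy

variable {d : ℕ}

/-- The measure with density `energyWeight`. -/
noncomputable def energyMeasure (d : ℕ) : Measure (EuclideanSpace ℝ (Fin d)) :=
  volume.withDensity fun t => ENNReal.ofReal (energyWeight t)

instance : SigmaFinite (energyMeasure d) := by
  unfold energyMeasure; infer_instance

lemma weightedNormSq_eq_integral_energyMeasure (f : EuclideanSpace ℝ (Fin d) → ℝ) :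
    weightedNormSq f = ∫ t, f t ^ 2 ∂(energyMeasure d) := by
  unfold weightedNormSq weightedInner energyMeasure
  rw [integral_withDensity_eq_integral_toReal_smul (by fun_prop)
    (ae_of_all _ fun t => ENNReal.ofReal_lt_top)]
  refine integral_congr_ae (ae_of_all _ fun t => ?_)
  simp only [ENNReal.toReal_ofReal (energyWeight_nonneg t), smul_eq_mul]
  ring

lemma integrable_mul_energyWeight_iff (f : EuclideanSpace ℝ (Fin d) → ℝ) :
    Integrable (fun t => f t * f t * energyWeight t) ↔
      Integrable (fun t => f t ^ 2) (energyMeasure d) := by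
  unfold energyMeasure
  rw [integrable_withDensity_iff (by fun_prop) (ae_of_all _ fun t => ENNReal.ofReal_lt_top)]
  simp only [ENNReal.toReal_ofReal (energyWeight_nonneg _), pow_two]

lemma IsLimitProcess.measurable_weightedNormSq {φ : EuclideanSpace ℝ (Fin d) → ℂ} {Ω' : Type*}
    [MeasurableSpace Ω'] {P' : Measure Ω'} {Z : EuclideanSpace ℝ (Fin d) → Ω' → ℝ}
    (hZ : IsLimitProcess φ Z P') :
    Measurable fun ω => weightedNormSq fun t => Z t ω := by
  simp only [weightedNormSq_eq_integral_energyMeasure]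
  exact measurable_integral_left (hZ.measurable.pow_const 2)

variable {μ : Measure (EuclideanSpace ℝ (Fin d))} [IsProbabilityMeasure μ]

/-- The variance is at most the mean squared distance to the constant `1 = cas t 0`. -/
lemma limitCov_self_le_integral (t : EuclideanSpace ℝ (Fin d)) :
    limitCov (charFun μ) t t ≤ ∫ x, 4 * (1 - Real.cos ⟪x, t⟫) ∂μ := by
  have e : ∀ x, (cas t x - cas t 0) ^ 2 = centeredCas μ t x * centeredCas μ t x +
      (2 * (∫ y, cas t y ∂μ - cas t 0) * centeredCas μ t x + (∫ y, cas t y ∂μ - cas t 0) ^ 2) := by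
    intro x; unfold centeredCas; ring
  have i0 := integrable_centeredCas_mul μ t t
  have i1 : Integrable (fun x => 2 * (∫ y, cas t y ∂μ - cas t 0) * centeredCas μ t x +
      (∫ y, cas t y ∂μ - cas t 0) ^ 2) μ :=
    ((integrable_centeredCas μ t).const_mul _).add (integrable_const _)
  calc limitCov (charFun μ) t t ≤ ∫ x, (cas t x - cas t 0) ^ 2 ∂μ := by
        simp only [e]
        rw [integral_add i0 i1, integral_add ((integrable_centeredCas μ t).const_mul _)
          (integrable_const _), integral_const_mul, integral_centeredCas, integral_centeredCas_mul]
        simp only [mul_zero, zero_add, integral_const, probReal_univ, one_smul]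
        linarith [sq_nonneg (∫ y, cas t y ∂μ - cas t 0)]
    _ ≤ _ := by
        refine integral_mono ?_ (((integrable_const _).sub (integrable_cos_inner μ t)).const_mul _)
          fun x => ?_
        · simp only [e]; exact i0.add i1
        · simpa using cas_sub_sq_le t x 0

/-- The expected squared norm of the limit process is finite under a first moment condition. -/
lemma lintegral_limitCov_ne_top (hμ : Integrable (fun x => ‖x‖) μ) :
    ∫⁻ t, ENNReal.ofReal (limitCov (charFun μ) t t) ∂(energyMeasure d) ≠ ∞ := by
  have hnn (t x : EuclideanSpace ℝ (Fin d)) : 0 ≤ 4 * (1 - Real.cos ⟪x, t⟫) := by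
    have := Real.cos_le_one ⟪x, t⟫; linarith
  have h1 (t : EuclideanSpace ℝ (Fin d)) : ENNReal.ofReal (limitCov (charFun μ) t t) ≤
      ∫⁻ x, ENNReal.ofReal (4 * (1 - Real.cos ⟪x, t⟫)) ∂μ := by
    have hi : Integrable (fun x => 4 * (1 - Real.cos ⟪x, t⟫)) μ :=
      ((integrable_const _).sub (integrable_cos_inner μ t)).const_mul _
    rw [← ofReal_integral_eq_lintegral_ofReal hi (ae_of_all _ (hnn t))]
    exact ENNReal.ofReal_le_ofReal (limitCov_self_le_integral t)
  have hmeas : Measurable fun p : EuclideanSpace ℝ (Fin d) × EuclideanSpace ℝ (Fin d) =>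
      ENNReal.ofReal (4 * (1 - Real.cos ⟪p.2, p.1⟫)) := by fun_prop
  have h2 (x : EuclideanSpace ℝ (Fin d)) :
      ∫⁻ t, ENNReal.ofReal (4 * (1 - Real.cos ⟪x, t⟫)) ∂(energyMeasure d) =
        4 * ENNReal.ofReal ‖x‖ := by
    unfold energyMeasure
    rw [lintegral_withDensity_eq_lintegral_mul _ (by fun_prop) (by fun_prop),
      ← lintegral_one_sub_cos_mul_energyWeight x, ← lintegral_const_mul _ (by fun_prop)]
    refine lintegral_congr fun t => ?_
    rw [Pi.mul_apply, ← ENNReal.ofReal_mul (energyWeight_nonneg t),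
      show (4 : ℝ≥0∞) = ENNReal.ofReal 4 by simp, ← ENNReal.ofReal_mul (by norm_num)]
    congr 1; ring
  refine ne_top_of_le_ne_top ?_ (lintegral_mono h1)
  rw [lintegral_lintegral_swap hmeas.aemeasurable]
  simp only [h2]
  rw [lintegral_const_mul _ (by fun_prop)]
  refine ENNReal.mul_ne_top (by norm_num) ?_
  rw [← ofReal_integral_eq_lintegral_ofReal hμ (ae_of_all _ fun x => norm_nonneg x)]
  exact ENNReal.ofReal_ne_top

variable {Ω' : Type*} [MeasurableSpace Ω'] {P' : Measure Ω'}
  {Z : EuclideanSpace ℝ (Fin d) → Ω' → ℝ}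

/-- Almost surely, the squared norm of the limit process is finite. -/
lemma IsLimitProcess.ae_integrable [SFinite P'] (hZ : IsLimitProcess (charFun μ) Z P')
    (hμ : Integrable (fun x => ‖x‖) μ) :
    ∀ᵐ ω ∂P', Integrable fun t => Z t ω * Z t ω * energyWeight t := by
  have hm : Measurable fun p : Ω' × EuclideanSpace ℝ (Fin d) => ‖Z p.2 p.1 ^ 2‖ₑ :=
    ((hZ.measurable.comp measurable_swap).pow_const 2).enorm
  have h : ∫⁻ ω, ∫⁻ t, ‖Z t ω ^ 2‖ₑ ∂(energyMeasure d) ∂P' ≠ ∞ := by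
    rw [lintegral_lintegral_swap hm.aemeasurable]
    simpa only [hZ.lintegral_enorm_sq] using lintegral_limitCov_ne_top hμ
  filter_upwards [ae_lt_top (Measurable.lintegral_prod_right' hm) h] with ω hω
  rw [integrable_mul_energyWeight_iff]
  exact ⟨((hZ.measurable.comp (measurable_prodMk_right (y := ω))).pow_const 2).aestronglyMeasurable,
    hω⟩

variable [IsProbabilityMeasure P'] {Ω : Type*} [MeasurableSpace Ω] {P : Measure Ω}
  [IsProbabilityMeasure P] {ι : Type*} {ξ : ι → Ω → EuclideanSpace ℝ (Fin d)}

/-- The energy quadratic form of an i.i.d. sample with negligible contrast weights converges in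
distribution to the squared norm of the limit process. -/
theorem IsNegligibleContrast.tendsto_energy {s : ℕ → Finset ι} {c : ℕ → ι → ℝ}
    (hc : IsNegligibleContrast s c)
    (hξ : ∀ i, Measurable (ξ i)) (hlaw : ∀ i, P.map (ξ i) = μ) (hind : iIndepFun ξ P)
    (hμ : Integrable (fun x => ‖x‖) μ) (hZ : IsLimitProcess (charFun μ) Z P')
    {h : ℝ → ℝ} {B : ℝ} {L : ℝ≥0} (hB : ∀ x, |h x| ≤ B) (hL : LipschitzWith L h) :
    Tendsto (fun k => ∫ ω, h (-∑ i ∈ s k, ∑ j ∈ s k, c k i * c k j * dist (ξ i ω) (ξ j ω)) ∂P)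
      atTop (𝓝 (∫ ω, h (weightedNormSq fun t => Z t ω) ∂P')) := by
  simp only [← fun k ω => weightedNormSq_sum_cas (s k) (c k) (hc.sum_eq_zero k) fun i => ξ i ω,
    weightedNormSq_eq_integral_energyMeasure]
  refine tendsto_integral_integral_of_tendsto_average
    (F := fun k t ω => (∑ i ∈ s k, c k i * cas t (ξ i ω)) ^ 2) (G := fun t ω => Z t ω ^ 2)
    (K := 48 * Real.exp (16 / 2)) (b := fun t => ENNReal.ofReal (limitCov (charFun μ) t t))
    (energyMeasure d) (fun k => ?_) (hZ.measurable.pow_const 2) (fun k t => ?_)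
    hZ.lintegral_pow_four_le (by positivity) (lintegral_limitCov_ne_top hμ)
    (fun k t => (lintegral_enorm_sum_cas_sq hξ hlaw hind (hc.sum_eq_zero k)
      (hc.sum_sq_eq_one k) t).le) (fun t => (hZ.lintegral_enorm_sq t).le)
    (fun h B L hB hL N u => ?_) hB hL
  · refine Measurable.pow_const (Finset.measurable_sum _ fun i _ => ?_) 2
    exact (measurable_cas.comp (measurable_fst.prodMk ((hξ i).comp measurable_snd))).const_mul _
  · exact lintegral_pow_four_le_of_hasSubgaussianMGF
      (hasSubgaussianMGF_sum_cas hξ hlaw hind (hc.sum_eq_zero k) (hc.sum_sq_eq_one k) t)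
  · exact hc.tendsto_integral_sum_cas hξ hlaw hind hZ u
      (f := fun x => h ((∑ j, x j ^ 2) / N)) (hL.continuous.comp (by fun_prop)) fun x => hB _

end Energy

/-! ### Complete-case counts and contrast weights -/

section CompleteCase

variable {d : ℕ}

lemma completeInd_eq_zero_or_one (r : Fin d → Bool) : completeInd r = 0 ∨ completeInd r = 1 := by
  by_cases h : ∀ k, r k = true
  · right; simp [completeInd, h]
  · left
    push Not at h
    obtain ⟨k, hk⟩ := h
    exact Finset.prod_eq_zero (Finset.mem_univ k) (by simp [hk])

lemma completeInd_nonneg (r : Fin d → Bool) : 0 ≤ completeInd r := by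
  rcases completeInd_eq_zero_or_one r with h | h <;> simp [h]

lemma completeInd_sq (r : Fin d → Bool) : completeInd r ^ 2 = completeInd r := by
  rcases completeInd_eq_zero_or_one r with h | h <;> simp [h]

lemma abs_completeInd_le (r : Fin d → Bool) : |completeInd r| ≤ 1 := by
  rcases completeInd_eq_zero_or_one r with h | h <;> simp [h]

/-- The complete-case energy statistic with its normalization. -/
noncomputable def scaledEnergyStatCC (n m : ℕ) (x y : ℕ → EuclideanSpace ℝ (Fin d))
    (rx ry : ℕ → Fin d → Bool) : ℝ :=
  completeCount n rx * completeCount m ry / (completeCount n rx + completeCount m ry) *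
    energyStatCC n m x y rx ry

/-- The weights, indexed by the pooled sample, that turn the normalized complete-case energy
statistic into an energy quadratic form. -/
noncomputable def contrastWeight (n m : ℕ) (rx ry : ℕ → Fin d → Bool) : ℕ ⊕ ℕ → ℝ :=
  Sum.elim
    (fun i => √(completeCount n rx * completeCount m ry /
      (completeCount n rx + completeCount m ry)) * (completeInd (rx i) / completeCount n rx))
    (fun j => -(√(completeCount n rx * completeCount m ry /
      (completeCount n rx + completeCount m ry)) * (completeInd (ry j) / completeCount m ry)))

variable {n m : ℕ} {rx ry : ℕ → Fin d → Bool}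

lemma sum_contrastWeight (hN : 0 < completeCount n rx) (hM : 0 < completeCount m ry) :
    ∑ i ∈ (Finset.range n).disjSum (Finset.range m), contrastWeight n m rx ry i = 0 := by
  have hN' : ∑ i ∈ Finset.range n, completeInd (rx i) = completeCount n rx := rfl
  have hM' : ∑ i ∈ Finset.range m, completeInd (ry i) = completeCount m ry := rfl
  rw [Finset.sum_disjSum]
  simp only [contrastWeight, Sum.elim_inl, Sum.elim_inr]
  rw [Finset.sum_neg_distrib, ← Finset.mul_sum, ← Finset.mul_sum, ← Finset.sum_div,
    ← Finset.sum_div, hN', hM', div_self hN.ne', div_self hM.ne']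
  ring

lemma sum_contrastWeight_sq (hN : 0 < completeCount n rx) (hM : 0 < completeCount m ry) :
    ∑ i ∈ (Finset.range n).disjSum (Finset.range m), contrastWeight n m rx ry i ^ 2 = 1 := by
  have hN' : ∑ i ∈ Finset.range n, completeInd (rx i) = completeCount n rx := rfl
  have hM' : ∑ i ∈ Finset.range m, completeInd (ry i) = completeCount m ry := rfl
  rw [Finset.sum_disjSum]
  simp only [contrastWeight, Sum.elim_inl, Sum.elim_inr, neg_sq, mul_pow, div_pow, completeInd_sq]
  rw [← Finset.mul_sum, ← Finset.mul_sum, ← Finset.sum_div, ← Finset.sum_div, hN', hM',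
    Real.sq_sqrt (by positivity)]
  field_simp
  ring

/-- Each weight is at most the inverse square root of the number of complete cases in its sample. -/
lemma abs_contrastWeight_le (hN : 0 < completeCount n rx) (hM : 0 < completeCount m ry) {δ : ℝ}
    (hδ : 0 < δ) (hNδ : (δ ^ 2)⁻¹ ≤ completeCount n rx) (hMδ : (δ ^ 2)⁻¹ ≤ completeCount m ry)
    (i : ℕ ⊕ ℕ) : |contrastWeight n m rx ry i| ≤ δ := by
  have key : ∀ A B a : ℝ, 0 < A → 0 < B → |a| ≤ 1 → (δ ^ 2)⁻¹ ≤ A →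
      |√(A * B / (A + B)) * (a / A)| ≤ δ := by
    intro A B a hA hB ha hAδ
    rw [abs_mul, abs_div, abs_of_pos hA, abs_of_nonneg (Real.sqrt_nonneg _)]
    calc √(A * B / (A + B)) * (|a| / A) ≤ √A * (1 / A) := by
          gcongr
          rw [div_le_iff₀ (by positivity)]
          nlinarith
      _ = √A⁻¹ := by
          rw [Real.sqrt_inv]
          have := Real.mul_self_sqrt hA.le
          have h0 : 0 < √A := Real.sqrt_pos.2 hA
          field_simp
          linarith
      _ ≤ δ := by
          rw [Real.sqrt_le_left hδ.le]
          exact inv_le_of_inv_le₀ (by positivity) hAδ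
  rcases i with i | j
  · exact key _ _ _ hN hM (abs_completeInd_le _) hNδ
  · simp only [contrastWeight, Sum.elim_inr, abs_neg]
    rw [mul_comm (completeCount n rx), add_comm (completeCount n rx)]
    exact key _ _ _ hM hN (abs_completeInd_le _) hMδ

lemma scaledEnergyStatCC_eq (hN : 0 < completeCount n rx) (hM : 0 < completeCount m ry)
    (x y : ℕ → EuclideanSpace ℝ (Fin d)) :
    scaledEnergyStatCC n m x y rx ry =
      -∑ i ∈ (Finset.range n).disjSum (Finset.range m),
        ∑ j ∈ (Finset.range n).disjSum (Finset.range m),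
          contrastWeight n m rx ry i * contrastWeight n m rx ry j *
            dist (Sum.elim x y i) (Sum.elim x y j) := by
  unfold scaledEnergyStatCC energyStatCC
  simp only [Finset.sum_disjSum, contrastWeight, Sum.elim_inl, Sum.elim_inr]
  generalize hA : completeCount n rx = A at *
  generalize hB : completeCount m ry = B at *
  have hs : √(A * B / (A + B)) * √(A * B / (A + B)) = A * B / (A + B) :=
    Real.mul_self_sqrt (by positivity)
  have e (a b p q D : ℝ) : √(A * B / (A + B)) * (a / p) * (√(A * B / (A + B)) * (b / q)) * D =
      A * B / (A + B) * ((p * q)⁻¹ * (D * a * b)) := by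
    rw [mul_inv]
    linear_combination (a * b * D * p⁻¹ * q⁻¹) * hs
  simp only [mul_neg, neg_mul, neg_neg, Finset.sum_neg_distrib, Finset.sum_add_distrib, e,
    ← Finset.mul_sum]
  have hcomm : ∑ i ∈ Finset.range m, ∑ j ∈ Finset.range n,
      dist (y i) (x j) * completeInd (ry i) * completeInd (rx j) =
      ∑ i ∈ Finset.range n, ∑ j ∈ Finset.range m,
      dist (x i) (y j) * completeInd (rx i) * completeInd (ry j) := by
    rw [Finset.sum_comm]
    refine Finset.sum_congr rfl fun i _ => Finset.sum_congr rfl fun j _ => ?_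
    rw [dist_comm]; ring
  rw [hcomm]
  generalize (∑ i ∈ Finset.range n, ∑ j ∈ Finset.range m,
      dist (x i) (y j) * completeInd (rx i) * completeInd (ry j)) = S₁
  field_simp
  ring

variable {Ω Ω' : Type*} [MeasurableSpace Ω] [MeasurableSpace Ω'] {P : Measure Ω} {P' : Measure Ω'}
  {μ : Measure (EuclideanSpace ℝ (Fin d))} {X Y : ℕ → Ω → EuclideanSpace ℝ (Fin d)}
  {Z : EuclideanSpace ℝ (Fin d) → Ω' → ℝ}

/-- Convergence for a fixed missingness pattern with infinitely many complete cases. -/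
theorem tendsto_scaledEnergyStatCC [IsProbabilityMeasure P] [IsProbabilityMeasure P']
    [IsProbabilityMeasure μ]
    (hX : ∀ i, Measurable (X i)) (hY : ∀ j, Measurable (Y j))
    (hXlaw : ∀ i, P.map (X i) = μ) (hYlaw : ∀ j, P.map (Y j) = μ)
    (hXY : iIndepFun (Sum.elim X Y) P) (hμ : Integrable (fun x => ‖x‖) μ)
    (hZ : IsLimitProcess (charFun μ) Z P') {n m : ℕ → ℕ} {rx ry : ℕ → Fin d → Bool}
    (hn : Tendsto (fun k => completeCount (n k) rx) atTop atTop)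
    (hm : Tendsto (fun k => completeCount (m k) ry) atTop atTop)
    {h : ℝ → ℝ} {B : ℝ} {L : ℝ≥0} (hB : ∀ x, |h x| ≤ B) (hL : LipschitzWith L h) :
    Tendsto (fun k => ∫ ω, h (scaledEnergyStatCC (n k) (m k) (fun i => X i ω) (fun j => Y j ω)
      rx ry) ∂P) atTop (𝓝 (∫ ω, h (weightedNormSq fun t => Z t ω) ∂P')) := by
  -- the weights are a contrast only once both samples have a complete case
  obtain ⟨k₀, hk₀⟩ := eventually_atTop.1
    ((hn.eventually_gt_atTop 0).and (hm.eventually_gt_atTop 0))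
  have hN (k : ℕ) := (hk₀ (k + k₀) (Nat.le_add_left _ _)).1
  have hM (k : ℕ) := (hk₀ (k + k₀) (Nat.le_add_left _ _)).2
  have hc : IsNegligibleContrast
      (fun k => (Finset.range (n (k + k₀))).disjSum (Finset.range (m (k + k₀))))
      (fun k => contrastWeight (n (k + k₀)) (m (k + k₀)) rx ry) := by
    refine ⟨fun k => sum_contrastWeight (hN k) (hM k),
      fun k => sum_contrastWeight_sq (hN k) (hM k), fun δ hδ => ?_⟩
    have hn' := (tendsto_add_atTop_iff_nat k₀).2 hn
    have hm' := (tendsto_add_atTop_iff_nat k₀).2 hm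
    filter_upwards [hn'.eventually_ge_atTop (δ ^ 2)⁻¹, hm'.eventually_ge_atTop (δ ^ 2)⁻¹]
      with k h1 h2 i _
    exact abs_contrastWeight_le (hN k) (hM k) hδ h1 h2 i
  refine (tendsto_add_atTop_iff_nat k₀).1 ?_
  have key := hc.tendsto_energy (ξ := Sum.elim X Y) (P := P) (μ := μ)
    (by rintro (i | j); exacts [hX i, hY j]) (by rintro (i | j); exacts [hXlaw i, hYlaw j])
    hXY hμ hZ hB hL
  refine key.congr fun k => integral_congr_ae (ae_of_all _ fun ω => ?_)
  simp only
  rw [scaledEnergyStatCC_eq (hN k) (hM k)]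
  congr 2
  refine Finset.sum_congr rfl fun i _ => Finset.sum_congr rfl fun j _ => ?_
  rcases i with i | i <;> rcases j with j | j <;> rfl

/-- By the second Borel–Cantelli lemma, almost surely infinitely many cases are complete. -/
lemma ae_tendsto_completeCount {R : ℕ → Ω → Fin d → Bool} (hR : ∀ i, Measurable (R i))
    (hind : iIndepFun R P) {q : ℝ} (hq : 0 < q) (hS : ∀ i, ∫ ω, completeInd (R i ω) ∂P = q) :
    ∀ᵐ ω ∂P, Tendsto (fun n => completeCount n fun i => R i ω) atTop atTop := by
  have := hind.isProbabilityMeasure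
  let A : Set (Fin d → Bool) := {r | completeInd r = 1}
  have hA : MeasurableSet A := MeasurableSet.of_discrete
  have hAm (i : ℕ) : MeasurableSet (R i ⁻¹' A) := hR i hA
  have hset : iIndepSet (fun i => R i ⁻¹' A) P := by
    rw [iIndepSet_iff_meas_biInter hAm]
    exact fun s => hind.measure_inter_preimage_eq_mul s fun i _ => hA
  have hP (i : ℕ) : P (R i ⁻¹' A) = ENNReal.ofReal q := by
    have e : (fun ω => completeInd (R i ω)) = (R i ⁻¹' A).indicator fun _ => (1 : ℝ) := by
      ext ω
      by_cases h : ω ∈ R i ⁻¹' A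
      · rw [Set.indicator_of_mem h]; exact h
      · rw [Set.indicator_of_notMem h]
        exact (completeInd_eq_zero_or_one _).resolve_right h
    have h := hS i
    rw [e, integral_indicator_const _ (hAm i), smul_eq_mul, mul_one] at h
    rw [← h, ofReal_measureReal]
  have hlim := measure_limsup_eq_one hAm hset (by
    simp only [hP]
    exact ENNReal.tsum_const_eq_top_of_ne_zero (by simpa using hq))
  have hmeas : MeasurableSet (limsup (fun i => R i ⁻¹' A) atTop) := .measurableSet_limsup hAm
  have hae : ∀ᵐ ω ∂P, ω ∈ limsup (fun i => R i ⁻¹' A) atTop :=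
    (mem_ae_iff_prob_eq_one hmeas).2 hlim
  filter_upwards [hae] with ω hω
  rw [mem_limsup_iff_frequently_mem] at hω
  refine (not_summable_iff_tendsto_nat_atTop_of_nonneg fun i => completeInd_nonneg _).1 fun hs => ?_
  have h0 := hs.tendsto_atTop_zero.eventually_lt_const (show (0 : ℝ) < 1 by norm_num)
  obtain ⟨i, h1, h2⟩ := (hω.and_eventually h0).exists
  have h1 : completeInd (R i ω) = 1 := h1
  linarith

lemma measurable_completeInd : Measurable (completeInd : (Fin d → Bool) → ℝ) :=
  Measurable.of_discrete

lemma measurable_scaledEnergyStatCC {α : Type*} [MeasurableSpace α] (n m : ℕ)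
    {x y : ℕ → α → EuclideanSpace ℝ (Fin d)} {rx ry : ℕ → α → Fin d → Bool}
    (hx : ∀ i, Measurable (x i)) (hy : ∀ j, Measurable (y j))
    (hrx : ∀ i, Measurable (rx i)) (hry : ∀ j, Measurable (ry j)) :
    Measurable fun a => scaledEnergyStatCC n m (fun i => x i a) (fun j => y j a)
      (fun i => rx i a) fun j => ry j a := by
  have h1 (i : ℕ) : Measurable fun a => completeInd (rx i a) := measurable_completeInd.comp (hrx i)
  have h2 (j : ℕ) : Measurable fun a => completeInd (ry j a) := measurable_completeInd.comp (hry j)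
  unfold scaledEnergyStatCC energyStatCC completeCount
  fun_prop

/-- Bounded Lipschitz test functions detect convergence in distribution. -/
lemma tendstoInDistribution_of_forall_lipschitz [IsProbabilityMeasure P] [IsProbabilityMeasure P']
    {T : ℕ → Ω → ℝ} {W : Ω' → ℝ} (hT : ∀ k, Measurable (T k)) (hW : Measurable W)
    (hlim : ∀ (h : ℝ → ℝ) (B : ℝ) (L : ℝ≥0), (∀ x, |h x| ≤ B) → LipschitzWith L h →
      Tendsto (fun k => ∫ ω, h (T k ω) ∂P) atTop (𝓝 (∫ ω, h (W ω) ∂P'))) :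
    TendstoInDistribution T atTop W (fun _ => P) P' where
  forall_aemeasurable k := (hT k).aemeasurable
  aemeasurable_limit := hW.aemeasurable
  tendsto := by
    refine tendsto_iff_forall_lipschitz_integral_tendsto.2 fun h ⟨C, hC⟩ ⟨L, hL⟩ => ?_
    have hB : ∀ x, |h x| ≤ |h 0| + C := by
      intro x
      have h1 := hC x 0
      rw [Real.dist_eq] at h1
      have h2 := abs_add_le (h 0) (h x - h 0)
      rw [add_sub_cancel] at h2
      linarith
    have hm : ∀ ρ : Measure ℝ, AEStronglyMeasurable h ρ := fun ρ =>
      hL.continuous.aestronglyMeasurable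
    have := hlim h _ L hB hL
    simp only [ProbabilityMeasure.coe_mk]
    rw [integral_map hW.aemeasurable (hm _)]
    refine this.congr fun k => ?_
    rw [integral_map (hT k).aemeasurable (hm _)]

/-- Independence allows the missingness pattern to be replaced by an independent copy. -/
lemma MCAR.integral_eq [IsProbabilityMeasure P] {RX RY : ℕ → Ω → Fin d → Bool}
    (h : MCAR X Y RX RY P)
    (hX : ∀ i, Measurable (X i)) (hY : ∀ j, Measurable (Y j))
    (hRX : ∀ i, Measurable (RX i)) (hRY : ∀ j, Measurable (RY j))
    {Φ : (ℕ ⊕ ℕ → EuclideanSpace ℝ (Fin d)) × (ℕ ⊕ ℕ → Fin d → Bool) → ℝ} (hΦ : Measurable Φ)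
    {B : ℝ} (hB : ∀ p, |Φ p| ≤ B) :
    ∫ ω, Φ (fun k => Sum.elim X Y k ω, fun k => Sum.elim RX RY k ω) ∂P =
      ∫ ω', ∫ ω, Φ (fun k => Sum.elim X Y k ω, fun k => Sum.elim RX RY k ω') ∂P ∂P := by
  have hXY : Measurable fun ω (k : ℕ ⊕ ℕ) => Sum.elim X Y k ω :=
    measurable_pi_lambda _ (by rintro (i | j); exacts [hX i, hY j])
  have hR : Measurable fun ω (k : ℕ ⊕ ℕ) => Sum.elim RX RY k ω :=
    measurable_pi_lambda _ (by rintro (i | j); exacts [hRX i, hRY j])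
  have := Measure.isProbabilityMeasure_map (μ := P) hXY.aemeasurable
  have := Measure.isProbabilityMeasure_map (μ := P) hR.aemeasurable
  have hprod := (indepFun_iff_map_prod_eq_prod_map_map hXY.aemeasurable hR.aemeasurable).1 h
  have h1 := integral_map (μ := P) (hXY.prodMk hR).aemeasurable hΦ.aestronglyMeasurable
  rw [← h1, hprod, integral_prod_symm _
    (integrable_of_abs_le hΦ.aestronglyMeasurable hB), integral_map hR.aemeasurable]
  · refine integral_congr_ae (ae_of_all _ fun ω' => ?_)
    simp only
    rw [integral_map hXY.aemeasurable]
    exact (hΦ.comp measurable_prodMk_right).aestronglyMeasurable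
  · exact (StronglyMeasurable.integral_prod_left' hΦ.stronglyMeasurable).aestronglyMeasurable

/-- The complete-case half of the theorem: conditionally on almost every missingness pattern the
complete cases are i.i.d. samples whose sizes tend to infinity. -/
lemma tendstoInDistribution_scaledEnergyStatCC [IsProbabilityMeasure P] [IsProbabilityMeasure P']
    {μ : Measure (EuclideanSpace ℝ (Fin d))} [IsProbabilityMeasure μ]
    (hX : ∀ i, Measurable (X i)) (hY : ∀ j, Measurable (Y j))
    (hXlaw : ∀ i, P.map (X i) = μ) (hYlaw : ∀ j, P.map (Y j) = μ)
    (hXY : iIndepFun (Sum.elim X Y) P) (hμ : Integrable (fun x => ‖x‖) μ)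
    {RX RY : ℕ → Ω → Fin d → Bool}
    (hRX : ∀ i, Measurable (RX i)) (hRY : ∀ j, Measurable (RY j))
    (hR : iIndepFun (Sum.elim RX RY) P) {q : ℝ} (hq : 0 < q)
    (hSX : ∀ i, ∫ ω, completeInd (RX i ω) ∂P = q) (hSY : ∀ j, ∫ ω, completeInd (RY j ω) ∂P = q)
    (hMCAR : MCAR X Y RX RY P) {n m : ℕ → ℕ} (hn : Tendsto n atTop atTop)
    (hm : Tendsto m atTop atTop) {Z : EuclideanSpace ℝ (Fin d) → Ω' → ℝ}
    (hZ : IsLimitProcess (charFun μ) Z P') :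
    TendstoInDistribution
      (fun k ω => scaledEnergyStatCC (n k) (m k) (fun i => X i ω) (fun j => Y j ω)
        (fun i => RX i ω) fun j => RY j ω)
      atTop (fun ω => weightedNormSq fun t => Z t ω) (fun _ => P) P' := by
  refine tendstoInDistribution_of_forall_lipschitz
    (fun k => measurable_scaledEnergyStatCC (n k) (m k) hX hY hRX hRY)
    hZ.measurable_weightedNormSq fun h B L hB hL => ?_
  have hhm : Measurable h := hL.continuous.measurable
  have hswap (k : ℕ) :
      ∫ ω, h (scaledEnergyStatCC (n k) (m k) (fun i => X i ω) (fun j => Y j ω)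
        (fun i => RX i ω) fun j => RY j ω) ∂P =
      ∫ ω', ∫ ω, h (scaledEnergyStatCC (n k) (m k) (fun i => X i ω) (fun j => Y j ω)
        (fun i => RX i ω') fun j => RY j ω') ∂P ∂P := by
    refine hMCAR.integral_eq hX hY hRX hRY (B := B)
      (Φ := fun p => h (scaledEnergyStatCC (n k) (m k) (fun i => p.1 (Sum.inl i))
        (fun j => p.1 (Sum.inr j)) (fun i => p.2 (Sum.inl i)) fun j => p.2 (Sum.inr j)))
      (hhm.comp (measurable_scaledEnergyStatCC _ _ ?_ ?_ ?_ ?_)) fun p => hB _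
    · exact fun i => (measurable_pi_apply _).comp measurable_fst
    · exact fun i => (measurable_pi_apply _).comp measurable_fst
    · exact fun i => (measurable_pi_apply _).comp measurable_snd
    · exact fun i => (measurable_pi_apply _).comp measurable_snd
  have hlim : ∫ ω, h (weightedNormSq fun t => Z t ω) ∂P' =
      ∫ _ω' : Ω, ∫ ω, h (weightedNormSq fun t => Z t ω) ∂P' ∂P := by simp
  simp only [hswap]
  rw [hlim]
  refine tendsto_integral_of_dominated_convergence (fun _ => B) (fun k => ?_)
    (integrable_const _) (fun k => ae_of_all _ fun ω' => ?_) ?_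
  · have hpair : Measurable fun p : Ω × Ω => h (scaledEnergyStatCC (n k) (m k)
        (fun i => X i p.2) (fun j => Y j p.2) (fun i => RX i p.1) fun j => RY j p.1) :=
      hhm.comp (measurable_scaledEnergyStatCC _ _ (fun i => (hX i).comp measurable_snd)
        (fun j => (hY j).comp measurable_snd) (fun i => (hRX i).comp measurable_fst)
        fun j => (hRY j).comp measurable_fst)
    exact (StronglyMeasurable.integral_prod_right' hpair.stronglyMeasurable).aestronglyMeasurable
  · refine (norm_integral_le_of_norm_le_const (ae_of_all _ fun ω => hB _)).trans ?_
    simp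
  · have hRXi : iIndepFun RX P := hR.precomp (g := Sum.inl) Sum.inl_injective
    have hRYi : iIndepFun RY P := hR.precomp (g := Sum.inr) Sum.inr_injective
    have hcX := ae_tendsto_completeCount hRX hRXi hq hSX
    have hcY := ae_tendsto_completeCount hRY hRYi hq hSY
    filter_upwards [hcX, hcY] with ω' h1 h2
    exact tendsto_scaledEnergyStatCC hX hY hXlaw hYlaw hXY hμ hZ (h1.comp hn) (h2.comp hm) hB hL

end CompleteCase

theorem theorem1 {d : ℕ} {Ω : Type*} [MeasurableSpace Ω] (P : Measure Ω) [IsProbabilityMeasure P]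
    -- the data: all `X i` and `Y j` are i.i.d. with law `μ`, which has a finite first moment
    (X Y : ℕ → Ω → EuclideanSpace ℝ (Fin d)) (μ : Measure (EuclideanSpace ℝ (Fin d)))
    (hX : ∀ i, Measurable (X i)) (hY : ∀ j, Measurable (Y j))
    (hXlaw : ∀ i, P.map (X i) = μ) (hYlaw : ∀ j, P.map (Y j) = μ)
    (hXY : iIndepFun (Sum.elim X Y) P)
    (hμ : Integrable (fun x => ‖x‖) μ)
    -- the response indicator vectors: independent over the cases
    (RX RY : ℕ → Ω → Fin d → Bool)
    (hRX : ∀ i, Measurable (RX i)) (hRY : ∀ j, Measurable (RY j))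
    (hR : iIndepFun (Sum.elim RX RY) P)
    -- a case is complete with the same positive probability `q` in both samples
    (q : ℝ) (hq : 0 < q)
    (hSX : ∀ i, ∫ ω, completeInd (RX i ω) ∂P = q) (hSY : ∀ j, ∫ ω, completeInd (RY j ω) ∂P = q)
    (hMCAR : MCAR X Y RX RY P)
    -- the sample sizes
    (n m : ℕ → ℕ) (hn : Tendsto n atTop atTop) (hm : Tendsto m atTop atTop) (lam : ℝ)
    (hlam : Tendsto (fun k => (n k : ℝ) / ((n k : ℝ) + (m k : ℝ))) atTop (𝓝 (lam ^ 2))) :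
    -- the limit process exists
    (∃ (Ω₀ : Type) (_ : MeasurableSpace Ω₀) (P₀ : Measure Ω₀) (_ : IsProbabilityMeasure P₀)
      (Z : EuclideanSpace ℝ (Fin d) → Ω₀ → ℝ), IsLimitProcess (charFun μ) Z P₀) ∧
    -- and for every version of it
    ∀ (Ω' : Type*) [MeasurableSpace Ω'] (P' : Measure Ω') [IsProbabilityMeasure P']
      (Z : EuclideanSpace ℝ (Fin d) → Ω' → ℝ), IsLimitProcess (charFun μ) Z P' →
      (∀ᵐ ω ∂P', Integrable (fun t => Z t ω * Z t ω * energyWeight t)) ∧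
      TendstoInDistribution
        (fun k ω => (n k : ℝ) * (m k : ℝ) / ((n k : ℝ) + (m k : ℝ)) *
          energyStat (n k) (m k) (fun i => X i ω) (fun j => Y j ω))
        atTop (fun ω => weightedNormSq (fun t => Z t ω)) (fun _ => P) P' ∧
      TendstoInDistribution
        (fun k ω =>
          completeCount (n k) (fun i => RX i ω) * completeCount (m k) (fun j => RY j ω) /
            (completeCount (n k) (fun i => RX i ω) + completeCount (m k) (fun j => RY j ω)) *
          energyStatCC (n k) (m k) (fun i => X i ω) (fun j => Y j ω)
            (fun i => RX i ω) (fun j => RY j ω))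
        atTop (fun ω => weightedNormSq (fun t => Z t ω)) (fun _ => P) P' := by
  have hμp : IsProbabilityMeasure μ := by
    rw [← hXlaw 0]; exact Measure.isProbabilityMeasure_map (hX 0).aemeasurable
  refine ⟨exists_isLimitProcess μ, fun Ω' _ P' _ Z hZ => ⟨hZ.ae_integrable hμ, ?_, ?_⟩⟩
  · -- the full-sample statistic is the complete-case statistic when nothing is missing
    have e : (fun (k : ℕ) (ω : Ω) => (n k : ℝ) * (m k : ℝ) / ((n k : ℝ) + (m k : ℝ)) *
        energyStat (n k) (m k) (fun i => X i ω) (fun j => Y j ω)) =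
        fun k ω => scaledEnergyStatCC (n k) (m k) (fun i => X i ω) (fun j => Y j ω)
          (fun _ _ => true) fun _ _ => true := by
      ext k ω
      simp [scaledEnergyStatCC, energyStatCC, energyStat, completeCount, completeInd]
    have hcount (N : ℕ) : completeCount N (fun _ (_ : Fin d) => true) = N := by
      simp [completeCount, completeInd]
    rw [e]
    refine tendstoInDistribution_of_forall_lipschitz (fun k => ?_) hZ.measurable_weightedNormSq
      fun h B L hB hL => tendsto_scaledEnergyStatCC hX hY hXlaw hYlaw hXY hμ hZ ?_ ?_ hB hL
    · exact measurable_scaledEnergyStatCC (n k) (m k) hX hY (fun _ => measurable_const)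
        fun _ => measurable_const
    · simp only [hcount]; exact tendsto_natCast_atTop_atTop.comp hn
    · simp only [hcount]; exact tendsto_natCast_atTop_atTop.comp hm
  · exact tendstoInDistribution_scaledEnergyStatCC hX hY hXlaw hYlaw hXY hμ hRX hRY hR hq hSX hSY
      hMCAR hn hm hZ
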